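/- Fix $T>0$. For $t\in[0,T]$ let $D(t)\subset\mathbb R^2$ be a bounded open set, let $D_0\subset\mathbb R^2$ be a bounded open set, and put $\mathcal O_T=\bigcup_{t\in[0,T]}D(t)\times\{t\}$ and $\widetilde{\mathcal O}_T=D_0\times[0,T]$. Assume that there is a level-preserving $C^\infty$-diffeomorphism $L(x,t)=(y^1(x,t),y^2(x,t),t)$ of $\overline{\mathcal O}_T$ onto $\overline{\widetilde{\mathcal O}}_T$ with $L(\mathcal O_T)=\widetilde{\mathcal O}_T$ ($L$ and $L^{-1}$ being restrictions of $C^\infty$ maps), such that $M(x,t)=(\partial y^j/\partial x^k)_{k,j}$ ($k$ the row index) satisfies $\det M(x,t)=J(t)^{-1}>0$, independently of $x$. For an open set $D\subset\mathbb R^2$ let $\mathscr C(D)=\{u\in C_0^\infty(D)^2:\operatorname{div}u=0\}$. Let $H_t$ be the closure of $\mathscr C(D(t))$ in $L^2(D(t))^2$, with inner product $(u,v)_t=\int_{D(t)}u\cdot v\,dx$ and norm $\|\cdot\|_t$; let $V_t$ and $\widetilde V$ be the closures of $\mathscr C(D(t))$ and of $\mathscr C(D_0)$ in $H^1_0(D(t))^2$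 and in $H^1_0(D_0)^2$, and put $\|\nabla u\|_t^2=\sum_{i,j}\int_{D(t)}|\partial u^i/\partial x^j|^2dx$ for $u\in V_t$. Extending fields on $D(t)$ by zero, regard $H_t$ as a subspace of $L^2(\mathbb R^2)^2$. Measurability of a map $g$ with $g(t)\in H_t$ is that of a map $[0,T]\to L^2(\mathbb R^2)^2$ (up to null sets of $t$), and $L^2([0,T];H_t)$ is the space of (classes of) measurable $g$ with $g(t)\in H_t$ for a.e. $t$ and $\int_0^T\|g(t)\|_t^2dt<\infty$, normed by the square root of this integral. Let $(e_n)_{n\ge1}$ be a linearly independent sequence in $\mathscr C(D_0)$ that is total in $\widetilde V$. For $t\in[0,T]$ let $(\widetilde w_n(t))_{n\ge1}$ be its Schmidt orthonormalization with respect to $$\langle u,v\rangle_t=\sum_{i,j=1}^2\int_{D_0}h_{ij}(y,t)\,u^i(y)\,v^j(y)\,J(t)\,dy,\qquad h_{ij}=\sum_{k=1}^2\frac{\partial x^k}{\partial y^i}\frac{\partial x^k}{\partial y^j},$$ where $L^{-1}(y,t)=(x^1(y,t),x^2(y,t),t)$, and put (vectors being rows) $w_n(x,t)=\widetilde w_n(L(x,t))\,M(x,t)^{-1}$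 for $x\in D(t)$. For each $i\ge1$ let $J_i$ be a (uniformly) equicontinuous family of real functions on $[0,T]$, that is, for every $\varepsilon>0$ there is $\delta>0$ such that $|h(t)-h(s)|<\varepsilon$ for all $h\in J_i$ and all $s,t\in[0,T]$ with $|s-t|<\delta$. For $N>0$ let $K_{N,J}$ be the set of all measurable $g$ with $g(t)\in H_t$ for every $t\in[0,T]$ and $g(t)\in V_t$ for a.e. $t$, such that $$\sup_{0\le t\le T}\|g(t)\|_t\le N,\qquad \int_0^T\|\nabla g(t)\|_t^2\,dt\le N,$$ and such that for every $i\ge1$ the function $t\mapsto(g(t),w_i(t))_t$ belongs to $J_i$. Then (the set of classes of elements of) $K_{N,J}$ is a precompact subset of $L^2([0,T];H_t)$: it is contained in this space and has compact closure there. -/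

import Mathlib

open MeasureTheory Set
open scoped ENNReal ContDiff

noncomputable section

/-- The Euclidean plane. -/
abbrev Plane : Type := EuclideanSpace ℝ (Fin 2)

/-- `2 × 2` arrays with the Frobenius norm; the values of gradients of planar vector fields. -/
abbrev Grad2 : Type := EuclideanSpace ℝ (Fin 2 × Fin 2)

/-- Square integrable vector fields on the plane. A square integrable field on a subset `D` is
regarded as an element of this space by extending it by zero. -/
abbrev L2Field : Type := Lp Plane 2 (volume : Measure Plane)

/-- Square integrable gradient fields on the plane. -/
abbrev L2Grad : Type := Lp Grad2 2 (volume : Measure Plane)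

/-- Lebesgue measure on the time interval `[0,T]`. -/
abbrev timeMeasure (T : ℝ) : Measure ℝ := volume.restrict (Icc 0 T)

/-! ### Divergence free fields and the spaces `H` and `V` of a planar open set -/

/-- The array `(∂ u^i / ∂ x^j)_{i,j}` at `x`. -/
def gradField (u : Plane → Plane) (x : Plane) : Grad2 :=
  WithLp.toLp 2 fun ij : Fin 2 × Fin 2 => fderiv ℝ u x (EuclideanSpace.single ij.2 1) ij.1

/-- The divergence of a vector field. -/
def divField (u : Plane → Plane) (x : Plane) : ℝ :=
  ∑ i : Fin 2, fderiv ℝ u x (EuclideanSpace.single i 1) i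

/-- Divergence free smooth vector fields with compact support in `D`
(as functions on the plane, vanishing outside `D`). -/
def solenoidalTest (D : Set Plane) : Set (Plane → Plane) :=
  {u | ContDiff ℝ ∞ u ∧ HasCompactSupport u ∧ tsupport u ⊆ D ∧ ∀ x, divField u x = 0}

/-- The pairs of classes `(u, ∇u)` for `u` in a set `S` of vector fields. -/
def gradGraph (S : Set (Plane → Plane)) : Set (L2Field × L2Grad) :=
  {p | ∃ u ∈ S, p.1 =ᵐ[volume] u ∧ p.2 =ᵐ[volume] gradField u}

/-- `H(D)`: the closure of the divergence free test fields in `L²`. -/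
def spaceH (D : Set Plane) : Set L2Field :=
  closure {f | ∃ u ∈ solenoidalTest D, f =ᵐ[volume] u}

/-- `f` lies in the closure of the divergence free test fields of `D` in `H¹₀`, with gradient `G`:
there are test fields `u_n` with `u_n → f` and `∇u_n → G` in `L²`. For bounded `D` convergence of
the gradients forces convergence of the fields (Poincaré inequality), and `G` is determined
by `f`, being its distributional gradient. -/
def HasGradV (D : Set Plane) (f : L2Field) (G : L2Grad) : Prop :=
  (f, G) ∈ closure (gradGraph (solenoidalTest D))

/-- `V(D)`: the closure of the divergence free test fields in `H¹₀`. -/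
def spaceV (D : Set Plane) : Set L2Field :=
  {f | ∃ G, HasGradV D f G}

/-- The norm `‖∇f‖` of the gradient of `f ∈ V(D)` (infinite if `f ∉ V(D)`). There is at most one
`G` with `HasGradV D f G`, so the infimum is its `L²` norm. -/
def gradNorm (D : Set Plane) (f : L2Field) : ℝ≥0∞ :=
  ⨅ (G : L2Grad) (_ : HasGradV D f G), ‖G‖ₑ

/-! ### The moving domain and its transformation to a fixed one -/

/-- The non-cylindrical space-time domain `⋃_{t ∈ [0,T]} D(t) × {t}`. -/
def spaceTime (T : ℝ) (D : ℝ → Set Plane) : Set (Plane × ℝ) :=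
  {p | p.2 ∈ Icc 0 T ∧ p.1 ∈ D p.2}

/-- For `F(x,t) = (y(x,t), t)`, the matrix whose entry in row `k`, column `j`
is `∂ y^j / ∂ x^k`. -/
def spatialJac (F : Plane × ℝ → Plane × ℝ) (p : Plane × ℝ) : Matrix (Fin 2) (Fin 2) ℝ :=
  Matrix.of fun k j => (fderiv ℝ F p (EuclideanSpace.single k 1, 0)).1 j

/-- A level preserving `C^∞` diffeomorphism `L` from the closure of the space-time domain of
`D` onto the closure of the cylinder over `D₀`, taking the domain `D(t)` to `D₀`
at each time, whose spatial Jacobian determinant `J(t)⁻¹` is positive and does not depend on the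
space variable. Smoothness on the (closed) closures means that the maps are restrictions of smooth
maps; the values of `L` and `Linv` outside of the closures are never used. -/
structure LevelDiffeo (T : ℝ) (D : ℝ → Set Plane) (D₀ : Set Plane) where
  /-- `L(x,t) = (y(x,t), t)` -/
  L : Plane × ℝ → Plane × ℝ
  /-- `L⁻¹(y,s) = (x(y,s), s)` -/
  Linv : Plane × ℝ → Plane × ℝ
  /-- the reciprocal of the spatial Jacobian determinant of `L` -/
  J : ℝ → ℝ
  contDiff_L : ContDiff ℝ ∞ L
  contDiff_Linv : ContDiff ℝ ∞ Linv
  bijOn : BijOn L (closure (spaceTime T D)) (closure (spaceTime T fun _ => D₀))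
  invOn : InvOn Linv L (closure (spaceTime T D)) (closure (spaceTime T fun _ => D₀))
  image_domain : L '' spaceTime T D = spaceTime T fun _ => D₀
  level : ∀ p ∈ closure (spaceTime T D), (L p).2 = p.2
  J_pos : ∀ t ∈ Icc 0 T, 0 < J t
  det_eq : ∀ p ∈ closure (spaceTime T D), (spatialJac L p).det = (J p.2)⁻¹

/-- Schmidt orthonormalization of a sequence `e` with respect to a bilinear form `B`:
`w_n = v_n / B(v_n,v_n)^{1/2}` with `v_n = e_n - ∑_{i<n} B(e_n,w_i) w_i`. -/
def schmidt {F : Type*} [AddCommGroup F] [Module ℝ F] (B : F → F → ℝ) (e : ℕ → F) (n : ℕ) : F :=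
  let v := e n - ∑ i : Fin n, B (e n) (schmidt B e i) • schmidt B e i
  (Real.sqrt (B v v))⁻¹ • v
termination_by n
decreasing_by exact i.2

namespace LevelDiffeo

variable {T : ℝ} {D : ℝ → Set Plane} {D₀ : Set Plane}

/-- `h_{ij}(y,t) = ∑_k (∂ x^k / ∂ y^i) (∂ x^k / ∂ y^j)`. -/
def metric (Φ : LevelDiffeo T D D₀) (i j : Fin 2) (y : Plane) (t : ℝ) : ℝ :=
  ∑ k : Fin 2, spatialJac Φ.Linv (y, t) i k * spatialJac Φ.Linv (y, t) j k

/-- `⟨u,v⟩_t = ∑_{i,j} ∫_{D₀} h_{ij}(y,t) u^i(y) v^j(y) J(t) dy`. -/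
def pairing (Φ : LevelDiffeo T D D₀) (t : ℝ) (u v : Plane → Plane) : ℝ :=
  ∑ i : Fin 2, ∑ j : Fin 2, ∫ y in D₀, Φ.metric i j y t * u y i * v y j * Φ.J t

/-- The Schmidt orthonormalization of `e` with respect to `⟨·,·⟩_t`, on the fixed domain. -/
def refBasis (Φ : LevelDiffeo T D D₀) (e : ℕ → Plane → Plane) (n : ℕ) (t : ℝ) :
    Plane → Plane :=
  schmidt (Φ.pairing t) e n

/-- The basis field `w_n(x,t) = w̃_n(L(x,t)) M(x,t)⁻¹` on the moving domain, where `w̃_n` is the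
basis field on the fixed domain, vectors are rows and `M` is the spatial Jacobian matrix of `L`.
Only the values for `x ∈ D(t)`, `t ∈ [0,T]` are used. -/
def movingBasis (Φ : LevelDiffeo T D D₀) (e : ℕ → Plane → Plane) (n : ℕ) (t : ℝ) (x : Plane) :
    Plane :=
  WithLp.toLp 2 (Matrix.vecMul (WithLp.ofLp (Φ.refBasis e n t (Φ.L (x, t)).1))
    (spatialJac Φ.L (x, t))⁻¹)

end LevelDiffeo

/-- A sequence of linearly independent divergence free test fields on `D₀` that is total
in `V(D₀)`: every divergence free test field is a limit, in `H¹₀`, of linear combinations. -/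
structure IsGalerkinSequence (D₀ : Set Plane) (e : ℕ → Plane → Plane) : Prop where
  mem : ∀ n, e n ∈ solenoidalTest D₀
  linearIndependent : LinearIndependent ℝ e
  total : gradGraph (solenoidalTest D₀) ⊆
    closure (gradGraph (Submodule.span ℝ (range e) : Set (Plane → Plane)))

/-! ### Function spaces over the moving domain, and the set `K_{N,J}` -/

/-- `L²([0,T]; H_t)`, as a subset (with the induced metric) of the Bochner space of square
integrable functions of `t ∈ [0,T]` with values in the square integrable vector fields. -/
def L2H (T : ℝ) (D : ℝ → Set Plane) : Set (Lp L2Field 2 (timeMeasure T)) :=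
  {f | ∀ᵐ t ∂timeMeasure T, f t ∈ spaceH (D t)}

/-- Equicontinuity on `[0,T]` of a family of real functions. -/
def EquicontFamily (T : ℝ) (A : Set (Icc (0 : ℝ) T → ℝ)) : Prop :=
  ∀ ε > 0, ∃ δ > 0, ∀ s t : Icc (0 : ℝ) T, |(s : ℝ) - t| < δ → ∀ h ∈ A, |h t - h s| < ε

/-- The functions `g` on `[0,T]` with `g(t) ∈ H_t`, measurable, that belong to
`L^∞([0,T];H_t) ∩ L²([0,T];V_t)`, satisfy `‖g(t)‖_t ≤ N` for every `t ∈ [0,T]` and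
`∫_0^T ‖∇g(t)‖_t² dt ≤ N`, and whose coefficient functions `t ↦ (g(t), w_i(t))_t` lie in
the prescribed families `A i`. -/
def setK {T : ℝ} {D : ℝ → Set Plane} {D₀ : Set Plane} (Φ : LevelDiffeo T D D₀)
    (e : ℕ → Plane → Plane) (N : ℝ) (A : ℕ → Set (Icc (0 : ℝ) T → ℝ)) : Set (ℝ → L2Field) :=
  {g | (∀ t ∈ Icc 0 T, g t ∈ spaceH (D t)) ∧
    MemLp g ∞ (timeMeasure T) ∧
    (∀ᵐ t ∂timeMeasure T, g t ∈ spaceV (D t)) ∧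
    (∀ t ∈ Icc 0 T, ‖g t‖ ≤ N) ∧
    ∫⁻ t in Icc 0 T, gradNorm (D t) (g t) ^ 2 ≤ ENNReal.ofReal N ∧
    ∀ i : ℕ, (fun t : Icc (0 : ℝ) T =>
      ∫ x in D t, inner ℝ (g t x) (Φ.movingBasis e i t x)) ∈ A i}

end

/-! The set is totally bounded in a complete space. The reason is Friedrichs' inequality, uniform
in time (`LevelDiffeo.exists_friedrichs`): for `ε > 0` there is an `n` such that
`‖u‖² - ∑_{i<n} (u, w_i(t))² ≤ ε (‖u‖² + ‖∇u‖²)` for all `t` and all `u ∈ V(D t)`. Integrated in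
time, it shows that an element `g` of the set is, up to a small error in `L²`, determined by its
first `n` coefficient functions. By equicontinuity these are determined, up to a small uniform
error, by their values at finitely many times (`EquicontFamily.exists_finite_times`), that is, by a
point of a bounded set in a finite dimensional space.

Friedrichs' inequality is first proved on the fixed domain `D₀`
(`IsGalerkinSequence.exists_uniform_approx`): by Rellich's theorem
(`exists_finite_net_of_energy_le`) the unit ball of `V(D₀)` has a finite `ε`-net in `L²`, and the
finitely many fields of the net are approximated by linear combinations of the `e_i`. Rellich's
theorem itself comes from comparing a field with its means over the cells of a fine square grid.

The inequality is carried to `D t` by transport of vector fields along the diffeomorphism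
(`transportField`), with constants bounded on the compact closed cylinder over `D₀`. Since the
Jacobian determinant is constant in space, transport maps divergence free test fields of `D₀` to
those of `D t` and back (`IsCoordChange.transportField_mem`); this is seen on the weak form of the
condition `div u = 0`, by a change of variables. Transport turns the pairing `⟨·,·⟩_t` into the
`L²` inner product, so the `w_i(t)` are the Schmidt orthonormalization in `L²` of the transported
`e_i`, and `‖u‖² - ∑_{i<n} (u, w_i(t))²` is the squared distance of `u` from the span of the first
`n` of these.

The Poincaré inequality is not needed, as `‖g(t)‖` is bounded on the set. Neither is the
measurability of `t ↦ ‖∇g(t)‖`: Friedrichs' inequality is applied to each `g` by itself, and not to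
differences, so that only the bound on the lower integral of `‖∇g(t)‖²` enters. -/

/-! ### Rellich's theorem -/

/-- Elements of a set `S` are classified, up to `δ`, by finitely many of them, if `φ` is bounded
on `S` with values in a proper space. -/
theorem exists_finite_net {α Y : Type*} [PseudoMetricSpace Y] [ProperSpace Y] {S : Set α}
    {φ : α → Y} (hb : Bornology.IsBounded (φ '' S)) {δ : ℝ} (hδ : 0 < δ) :
    ∃ F : Set α, F.Finite ∧ F ⊆ S ∧ ∀ v ∈ S, ∃ w ∈ F, dist (φ v) (φ w) < δ := by
  obtain ⟨t, hts, htf, ht⟩ := Metric.finite_approx_of_totallyBounded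
    (hb.isCompact_closure.totallyBounded.subset subset_closure) δ hδ
  choose σ hσS hσ using fun y : t => hts y.2
  have := htf.to_subtype
  refine ⟨range σ, finite_range σ, range_subset_iff.2 hσS, fun v hv => ?_⟩
  obtain ⟨y, hy, hvy⟩ := mem_iUnion₂.1 (ht (mem_image_of_mem φ hv))
  exact ⟨σ ⟨y, hy⟩, mem_range_self _, by rwa [hσ ⟨y, hy⟩]⟩

/-- The Cauchy–Schwarz inequality against the constant function `1`. -/
theorem sq_lintegral_le {α : Type*} [MeasurableSpace α] (μ : Measure α) {f : α → ℝ≥0∞}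
    (hf : AEMeasurable f μ) : (∫⁻ x, f x ∂μ) ^ 2 ≤ μ univ * ∫⁻ x, f x ^ 2 ∂μ := by
  have h := ENNReal.lintegral_mul_le_Lp_mul_Lq μ Real.HolderConjugate.two_two hf
    (aemeasurable_const (b := (1 : ℝ≥0∞)))
  simp only [Pi.mul_apply, mul_one, ENNReal.one_rpow, lintegral_const, one_mul] at h
  have h2 : ∀ a : ℝ≥0∞, (a ^ (1 / 2 : ℝ)) ^ 2 = a := fun a => by
    rw [← ENNReal.rpow_natCast, ← ENNReal.rpow_mul]; norm_num
  calc (∫⁻ x, f x ∂μ) ^ 2 ≤ _ := pow_le_pow_left' h 2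
    _ = _ := by rw [mul_pow, h2, h2, mul_comm]; simp

theorem ENNReal.add_sq_le_two (a b : ℝ≥0∞) : (a + b) ^ 2 ≤ 2 * a ^ 2 + 2 * b ^ 2 := by
  have h := ENNReal.rpow_add_le_mul_rpow_add_rpow a b (p := 2) (by norm_num)
  norm_num at h
  rwa [mul_add] at h

/-- Translating by `h` moves `u` by at most `‖h‖ ‖Du‖` in `L²`. -/
theorem lintegral_enorm_translate_sub_sq_le {u : Plane → Plane} (hu : ContDiff ℝ 1 u) (h : Plane) :
    ∫⁻ x, ‖u (x + h) - u x‖ₑ ^ 2 ≤ ‖h‖ₑ ^ 2 * ∫⁻ x, ‖fderiv ℝ u x‖ₑ ^ 2 := by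
  have hc : Continuous (fderiv ℝ u) := hu.continuous_fderiv one_ne_zero
  have key : ∀ x, ‖u (x + h) - u x‖ₑ ^ 2 ≤
      ∫⁻ s in Ioc (0 : ℝ) 1, ‖h‖ₑ ^ 2 * ‖fderiv ℝ u (x + s • h)‖ₑ ^ 2 := by
    intro x
    have hd : ∀ s ∈ uIcc (0 : ℝ) 1,
        HasDerivAt (fun s : ℝ => u (x + s • h)) (fderiv ℝ u (x + s • h) h) s := by
      intro s _
      have h1 : HasDerivAt (fun s : ℝ => x + s • h) h s := by
        simpa using ((hasDerivAt_id s).smul_const h).const_add x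
      exact ((hu.differentiable one_ne_zero) _).hasFDerivAt.comp_hasDerivAt s h1
    have hci : Continuous fun s : ℝ => fderiv ℝ u (x + s • h) h :=
      (hc.comp (by fun_prop)).clm_apply continuous_const
    have h2 := intervalIntegral.integral_eq_sub_of_hasDerivAt hd (hci.intervalIntegrable 0 1)
    simp only [one_smul, zero_smul, add_zero] at h2
    rw [← h2, intervalIntegral.integral_of_le zero_le_one]
    calc _ ≤ (∫⁻ s in Ioc (0 : ℝ) 1, ‖fderiv ℝ u (x + s • h) h‖ₑ) ^ 2 :=
          pow_le_pow_left' (enorm_integral_le_lintegral_enorm _) 2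
      _ ≤ ∫⁻ s in Ioc (0 : ℝ) 1, ‖fderiv ℝ u (x + s • h) h‖ₑ ^ 2 := by
          simpa using sq_lintegral_le (volume.restrict (Ioc (0 : ℝ) 1))
            hci.measurable.enorm.aemeasurable
      _ ≤ _ := by
          refine lintegral_mono fun s => ?_
          rw [mul_comm, ← mul_pow]
          exact pow_le_pow_left' (ContinuousLinearMap.le_opENorm _ _) 2
  calc _ ≤ _ := lintegral_mono key
    _ = ∫⁻ s in Ioc (0 : ℝ) 1, ∫⁻ x, ‖h‖ₑ ^ 2 * ‖fderiv ℝ u (x + s • h)‖ₑ ^ 2 := by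
        refine lintegral_lintegral_swap (Continuous.aemeasurable ?_)
        have : Continuous fun p : Plane × ℝ => fderiv ℝ u (p.1 + p.2 • h) := hc.comp (by fun_prop)
        have h3 : Continuous fun p : Plane × ℝ => ‖fderiv ℝ u (p.1 + p.2 • h)‖ₑ := this.enorm
        exact (ENNReal.continuous_const_mul (by simp)).comp ((ENNReal.continuous_pow 2).comp h3)
    _ = ∫⁻ s in Ioc (0 : ℝ) 1, ‖h‖ₑ ^ 2 * ∫⁻ x, ‖fderiv ℝ u x‖ₑ ^ 2 := by
        refine lintegral_congr fun s => ?_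
        rw [lintegral_const_mul' _ _ (by simp)]
        rw [lintegral_add_right_eq_self (fun x => ‖fderiv ℝ u x‖ₑ ^ 2)]
    _ = _ := by simp

/-- On a set of finite measure, `u` is controlled by its mean and its mean squared oscillation. -/
theorem measure_mul_setLIntegral_enorm_sq_le {u : Plane → Plane} (hu : Continuous u)
    {Q : Set Plane} (hQi : IntegrableOn u Q) (hQ : volume Q ≠ ⊤) :
    volume Q * ∫⁻ x in Q, ‖u x‖ₑ ^ 2 ≤ 2 * ‖∫ x in Q, u x‖ₑ ^ 2 +
      2 * ∫⁻ x in Q, ∫⁻ y in Q, ‖u y - u x‖ₑ ^ 2 := by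
  rcases eq_or_ne (volume Q) 0 with h0 | h0
  · simp [h0]
  have key : ∀ x, volume Q * (volume Q * ‖u x‖ₑ ^ 2) ≤ 2 * ‖∫ x in Q, u x‖ₑ ^ 2 +
      2 * (volume Q * ∫⁻ y in Q, ‖u y - u x‖ₑ ^ 2) := by
    intro x
    have h1 : volume.real Q • u x = (∫ y in Q, u y) - ∫ y in Q, (u y - u x) := by
      rw [integral_sub hQi (integrableOn_const hQ)]
      simp
    have h2 : volume Q * ‖u x‖ₑ ≤ ‖∫ y in Q, u y‖ₑ + ∫⁻ y in Q, ‖u y - u x‖ₑ := by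
      have : volume Q = ‖volume.real Q‖ₑ := by
        rw [Real.enorm_of_nonneg measureReal_nonneg, measureReal_def, ENNReal.ofReal_toReal hQ]
      rw [this, ← enorm_smul, h1]
      exact enorm_sub_le.trans (by gcongr; exact enorm_integral_le_lintegral_enorm _)
    calc volume Q * (volume Q * ‖u x‖ₑ ^ 2) = (volume Q * ‖u x‖ₑ) ^ 2 := by ring
      _ ≤ _ := pow_le_pow_left' h2 2
      _ ≤ _ := ENNReal.add_sq_le_two _ _
      _ ≤ _ := by
        gcongr
        have := sq_lintegral_le (volume.restrict Q) (f := fun y => ‖u y - u x‖ₑ)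
          (by fun_prop)
        rwa [Measure.restrict_apply_univ] at this
  have h3 := lintegral_mono (μ := volume.restrict Q) key
  have hm : Measurable fun x => ∫⁻ y in Q, ‖u y - u x‖ₑ ^ 2 := by
    refine Measurable.lintegral_prod_right' (f := fun p : Plane × Plane => ‖u p.2 - u p.1‖ₑ ^ 2) ?_
    fun_prop
  rw [lintegral_const_mul' _ _ hQ, lintegral_const_mul' _ _ hQ,
    lintegral_add_left measurable_const, lintegral_const_mul' _ _ (by simp),
    lintegral_const_mul' _ _ (by simp), lintegral_const_mul' _ _ hQ, lintegral_const,
    Measure.restrict_apply_univ] at h3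
  refine (ENNReal.mul_le_mul_iff_right h0 hQ).1 (h3.trans (le_of_eq ?_))
  ring

/-- A function is controlled by its means over the cells of a finite partition into small cells
of equal measure, up to the size `r` of the cells times its gradient: on a cell, the deviation from
the mean is an average of differences `u (x + h) - u x` with `h` in the difference set `B`. -/
theorem measure_mul_lintegral_enorm_sq_le {u : Plane → Plane} (hu : ContDiff ℝ 1 u)
    (hsu : HasCompactSupport u) {ι : Type*} [Fintype ι] {Q : ι → Set Plane}
    (hQm : ∀ k, MeasurableSet (Q k)) (hQd : Pairwise (Function.onFun Disjoint Q))
    {c : ℝ≥0∞} (hc : c ≠ ⊤) (hQc : ∀ k, volume (Q k) = c)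
    (hcover : Function.support u ⊆ ⋃ k, Q k)
    {B : Set Plane} (hBm : MeasurableSet B) (hB : ∀ k, ∀ x ∈ Q k, ∀ y ∈ Q k, y - x ∈ B)
    {r : ℝ≥0∞} (hr : ∀ h ∈ B, ‖h‖ₑ ≤ r) :
    c * ∫⁻ x, ‖u x‖ₑ ^ 2 ≤ 2 * ∑ k, ‖∫ x in Q k, u x‖ₑ ^ 2 +
      2 * (volume B * (r ^ 2 * ∫⁻ x, ‖fderiv ℝ u x‖ₑ ^ 2)) := by
  have huc := hu.continuous
  have h1 : ∫⁻ x, ‖u x‖ₑ ^ 2 ≤ ∑ k, ∫⁻ x in Q k, ‖u x‖ₑ ^ 2 := by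
    calc ∫⁻ x, ‖u x‖ₑ ^ 2 = ∫⁻ x in ⋃ k, Q k, ‖u x‖ₑ ^ 2 := by
          refine (setLIntegral_eq_of_support_subset fun x hx => hcover ?_).symm
          simp only [Function.mem_support] at hx ⊢
          contrapose! hx
          simp [hx]
      _ ≤ ∑' k, ∫⁻ x in Q k, ‖u x‖ₑ ^ 2 := lintegral_iUnion_le _ _
      _ = _ := tsum_fintype _
  have h2 : ∑ k, ∫⁻ x in Q k, ∫⁻ y in Q k, ‖u y - u x‖ₑ ^ 2 ≤
      volume B * (r ^ 2 * ∫⁻ x, ‖fderiv ℝ u x‖ₑ ^ 2) := by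
    calc ∑ k, ∫⁻ x in Q k, ∫⁻ y in Q k, ‖u y - u x‖ₑ ^ 2
        ≤ ∑ k, ∫⁻ x in Q k, ∫⁻ h in B, ‖u (x + h) - u x‖ₑ ^ 2 := by
          refine Finset.sum_le_sum fun k _ => setLIntegral_mono' (hQm k) fun x hx => ?_
          rw [← lintegral_indicator (hQm k), ← lintegral_indicator hBm,
            ← lintegral_add_left_eq_self _ x]
          refine lintegral_mono fun h => ?_
          simp only [indicator]
          split_ifs with h3 h4
          · exact le_rfl
          · exact absurd (by simpa using hB k x hx _ h3) h4
          · exact zero_le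
          · exact le_rfl
      _ = ∫⁻ x in ⋃ k, Q k, ∫⁻ h in B, ‖u (x + h) - u x‖ₑ ^ 2 := by
          rw [lintegral_iUnion hQm hQd, tsum_fintype]
      _ ≤ ∫⁻ x, ∫⁻ h in B, ‖u (x + h) - u x‖ₑ ^ 2 := setLIntegral_le_lintegral _ _
      _ = ∫⁻ h in B, ∫⁻ x, ‖u (x + h) - u x‖ₑ ^ 2 := by
          refine lintegral_lintegral_swap ?_
          fun_prop
      _ ≤ ∫⁻ _ in B, r ^ 2 * ∫⁻ x, ‖fderiv ℝ u x‖ₑ ^ 2 := by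
          refine setLIntegral_mono' hBm fun h hh =>
            (lintegral_enorm_translate_sub_sq_le hu h).trans ?_
          gcongr
          exact hr h hh
      _ = _ := by simp [mul_comm]
  calc c * ∫⁻ x, ‖u x‖ₑ ^ 2 ≤ ∑ k, c * ∫⁻ x in Q k, ‖u x‖ₑ ^ 2 := by
        rw [← Finset.mul_sum]; gcongr
    _ ≤ ∑ k, (2 * ‖∫ x in Q k, u x‖ₑ ^ 2 + 2 * ∫⁻ x in Q k, ∫⁻ y in Q k, ‖u y - u x‖ₑ ^ 2) := by
        refine Finset.sum_le_sum fun k _ => ?_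
        rw [← hQc k]
        exact measure_mul_setLIntegral_enorm_sq_le huc
          (huc.integrable_of_hasCompactSupport hsu).integrableOn (by rw [hQc k]; exact hc)
    _ ≤ _ := by
        rw [Finset.sum_add_distrib, ← Finset.mul_sum, ← Finset.mul_sum]
        gcongr

theorem volume_plane_box (s : Fin 2 → Set ℝ) (hs : ∀ i, MeasurableSet (s i)) :
    MeasurableSet {x : Plane | ∀ i, x i ∈ s i} ∧
      volume {x : Plane | ∀ i, x i ∈ s i} = volume (s 0) * volume (s 1) := by
  have hp : {x : Plane | ∀ i, x i ∈ s i} = WithLp.ofLp ⁻¹' (univ.pi s) := by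
    ext x; simp
  have hm : MeasurableSet (univ.pi s) := MeasurableSet.univ_pi hs
  have hv := PiLp.volume_preserving_ofLp (Fin 2)
  rw [hp]
  refine ⟨hv.measurable hm, ?_⟩
  rw [hv.measure_preimage hm.nullMeasurableSet, volume_pi_pi, Fin.prod_univ_two]

/-- A bounded set is covered by finitely many cells of a square grid of mesh `δ`. -/
theorem exists_square_cells {D : Set Plane} (hD : Bornology.IsBounded D) {δ : ℝ} (hδ : 0 < δ) :
    ∃ (ι : Type) (_ : Fintype ι) (Q : ι → Set Plane), (∀ k, MeasurableSet (Q k)) ∧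
      Pairwise (Function.onFun Disjoint Q) ∧ (∀ k, volume (Q k) = ENNReal.ofReal (δ ^ 2)) ∧
      D ⊆ (⋃ k, Q k) ∧
      ∀ k, ∀ x ∈ Q k, ∀ y ∈ Q k, y - x ∈ {h : Plane | ∀ i, h i ∈ Ioo (-δ) δ} := by
  obtain ⟨R, hR⟩ := hD.exists_norm_le
  obtain ⟨m, hm⟩ := exists_nat_gt (R / δ)
  let s : ℤ → Set ℝ := fun k => Ico (δ * k) (δ * (k + 1))
  have hsv : ∀ k, volume (s k) = ENNReal.ofReal δ := fun k => by
    rw [Real.volume_Ico]; congr 1; ring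
  have hfl : ∀ (a : ℝ) (k : ℤ), a ∈ s k → k = ⌊a / δ⌋ := fun a k ha => by
    refine (Int.floor_eq_iff.2 ⟨?_, ?_⟩).symm
    · rw [le_div_iff₀ hδ, mul_comm]; exact ha.1
    · rw [div_lt_iff₀ hδ, mul_comm]; exact ha.2
  refine ⟨Fin 2 → Finset.Icc (-(m : ℤ)) m, inferInstance, fun k => {x | ∀ i, x i ∈ s (k i)},
    fun k => (volume_plane_box _ fun _ => measurableSet_Ico).1, ?_, fun k => ?_, ?_, ?_⟩
  · intro k l hkl
    refine Set.disjoint_left.2 fun x hx hx' => hkl ?_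
    funext i
    exact Subtype.ext ((hfl _ _ (hx i)).trans (hfl _ _ (hx' i)).symm)
  · rw [(volume_plane_box _ fun _ => measurableSet_Ico).2, hsv, hsv,
      ← ENNReal.ofReal_mul hδ.le, sq]
  · intro x hx
    have hxi : ∀ i, |x i / δ| < m := fun i => by
      rw [abs_div, abs_of_pos hδ]
      refine lt_of_le_of_lt ?_ hm
      gcongr
      exact (PiLp.norm_apply_le x i).trans (hR x hx)
    have hk : ∀ i, ⌊x i / δ⌋ ∈ Finset.Icc (-(m : ℤ)) m := fun i => by
      have := abs_lt.1 (hxi i)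
      rw [Finset.mem_Icc]
      constructor
      · rw [Int.le_floor]; push_cast; exact this.1.le
      · have h1 : (⌊x i / δ⌋ : ℝ) ≤ ((m : ℤ) : ℝ) := (Int.floor_le (x i / δ)).trans this.2.le
        exact Int.cast_le.1 h1
    refine mem_iUnion.2 ⟨fun i => ⟨_, hk i⟩, fun i => ⟨?_, ?_⟩⟩
    · rw [mul_comm, ← le_div_iff₀ hδ]; exact Int.floor_le _
    · rw [mul_comm, ← div_lt_iff₀ hδ]; exact Int.lt_floor_add_one _
  · intro k x hx y hy i
    have h1 := hx i
    have h2 := hy i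
    simp only [s, mem_Ico, PiLp.sub_apply, mem_Ioo] at h1 h2 ⊢
    constructor <;> nlinarith [h1.1, h1.2, h2.1, h2.2]

/-- Rellich's theorem: a set of smooth fields that is bounded in `H¹₀` of a bounded
set is totally bounded in `L²`. -/
theorem exists_finite_net_of_energy_le {D : Set Plane} (hD : Bornology.IsBounded D)
    {S : Set (Plane → Plane)}
    (hS : ∀ v ∈ S, ContDiff ℝ 1 v ∧ HasCompactSupport v ∧ Function.support v ⊆ D ∧
      ∫⁻ x, ‖v x‖ₑ ^ 2 ≤ 1 ∧ ∫⁻ x, ‖fderiv ℝ v x‖ₑ ^ 2 ≤ 1) {ε : ℝ} (hε : 0 < ε) :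
    ∃ F : Set (Plane → Plane), F.Finite ∧ F ⊆ S ∧
      ∀ v ∈ S, ∃ w ∈ F, ∫⁻ x, ‖v x - w x‖ₑ ^ 2 ≤ ENNReal.ofReal ε := by
  -- The grid has cells of measure `δ²`, with difference set in a square of measure `4 δ²`, on which
  -- `‖h‖ ≤ 2 δ`; the gradient of a difference of members of `S` has energy at most `4`. The gradient
  -- term in the cell inequality is thus at most `2 * 4 * 4 * 4 * δ²` times the measure of a cell.
  obtain ⟨δ, hδ, hδε⟩ : ∃ δ : ℝ, 0 < δ ∧ 128 * δ ^ 2 ≤ ε / 2 := by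
    refine ⟨min 1 (ε / 256), by positivity, ?_⟩
    have h0 : 0 < min 1 (ε / 256) := by positivity
    nlinarith [min_le_left 1 (ε / 256), min_le_right 1 (ε / 256)]
  obtain ⟨ι, _, Q, hQm, hQd, hQv, hQc, hQB⟩ := exists_square_cells hD hδ
  set B : Set Plane := {h : Plane | ∀ i, h i ∈ Ioo (-δ) δ} with hBdef
  have hB := volume_plane_box (fun _ => Ioo (-δ) δ) fun _ => measurableSet_Ioo
  have hBv : volume B = ENNReal.ofReal (4 * δ ^ 2) := by
    rw [hB.2, Real.volume_Ioo, ← ENNReal.ofReal_mul (by linarith)]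
    congr 1; ring
  have hBr : ∀ h ∈ B, ‖h‖ₑ ≤ ENNReal.ofReal (2 * δ) := by
    intro h hh
    rw [← ofReal_norm]
    refine ENNReal.ofReal_le_ofReal (abs_le_of_sq_le_sq' ?_ (by positivity)).2
    rw [EuclideanSpace.norm_sq_eq, Fin.sum_univ_two, Real.norm_eq_abs, Real.norm_eq_abs,
      sq_abs, sq_abs]
    nlinarith [(hh 0).1, (hh 0).2, (hh 1).1, (hh 1).2]
  -- The integrals over the cells are bounded on `S`.
  let φ : (Plane → Plane) → ι → Plane := fun v k => ∫ x in Q k, v x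
  have hφb : Bornology.IsBounded (φ '' S) := by
    refine isBounded_iff_forall_norm_le.2 ⟨δ, ?_⟩
    rintro _ ⟨v, hv, rfl⟩
    obtain ⟨hv1, hv2, -, hv3, -⟩ := hS v hv
    refine (pi_norm_le_iff_of_nonneg hδ.le).2 fun k => ?_
    have h1 : ‖φ v k‖ₑ ^ 2 ≤ ENNReal.ofReal (δ ^ 2) := by
      calc ‖φ v k‖ₑ ^ 2 ≤ (∫⁻ x in Q k, ‖v x‖ₑ) ^ 2 :=
            pow_le_pow_left' (enorm_integral_le_lintegral_enorm _) 2
        _ ≤ volume.restrict (Q k) univ * ∫⁻ x in Q k, ‖v x‖ₑ ^ 2 :=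
            sq_lintegral_le _ hv1.continuous.measurable.enorm.aemeasurable
        _ ≤ ENNReal.ofReal (δ ^ 2) * 1 := by
            rw [Measure.restrict_apply_univ, hQv]
            gcongr
            exact (setLIntegral_le_lintegral _ _).trans hv3
        _ = _ := mul_one _
    rw [← ofReal_norm, ← ENNReal.ofReal_pow (norm_nonneg _),
      ENNReal.ofReal_le_ofReal_iff (by positivity)] at h1
    exact (abs_le_of_sq_le_sq' h1 hδ.le).2
  obtain ⟨η, hη, hηε⟩ : ∃ η : ℝ, 0 < η ∧ 2 * (Fintype.card ι * η ^ 2) ≤ δ ^ 2 * (ε / 2) := by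
    set a : ℝ := δ ^ 2 * ε / (4 * (Fintype.card ι + 1)) with ha
    have ha0 : 0 < a := by positivity
    refine ⟨min 1 a, by positivity, ?_⟩
    have h0 : 0 < min 1 a := by positivity
    have h1 : min 1 a ^ 2 ≤ a := by
      nlinarith [min_le_left 1 a, min_le_right 1 a]
    have h2 : a * (4 * (Fintype.card ι + 1)) = δ ^ 2 * ε := by
      rw [ha]; field_simp
    have h3 : (Fintype.card ι : ℝ) * min 1 a ^ 2 ≤ Fintype.card ι * a := by gcongr
    linarith
  obtain ⟨F, hFf, hFS, hF⟩ := exists_finite_net hφb hη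
  refine ⟨F, hFf, hFS, fun v hv => ?_⟩
  obtain ⟨w, hw, hvw⟩ := hF v hv
  refine ⟨w, hw, ?_⟩
  obtain ⟨hv1, hv2, hv3, -, hv4⟩ := hS v hv
  obtain ⟨hw1, hw2, hw3, -, hw4⟩ := hS w (hFS hw)
  have hgrad : ∫⁻ x, ‖fderiv ℝ (v - w) x‖ₑ ^ 2 ≤ 4 := by
    calc ∫⁻ x, ‖fderiv ℝ (v - w) x‖ₑ ^ 2
        ≤ ∫⁻ x, (2 * ‖fderiv ℝ v x‖ₑ ^ 2 + 2 * ‖fderiv ℝ w x‖ₑ ^ 2) := by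
          refine lintegral_mono fun x => ?_
          rw [fderiv_sub (hv1.differentiable one_ne_zero x) (hw1.differentiable one_ne_zero x)]
          exact (pow_le_pow_left' enorm_sub_le 2).trans (ENNReal.add_sq_le_two _ _)
      _ ≤ 2 * 1 + 2 * 1 := by
          have := (hv1.continuous_fderiv one_ne_zero).measurable
          rw [lintegral_add_left (by fun_prop), lintegral_const_mul' _ _ (by simp),
            lintegral_const_mul' _ _ (by simp)]
          gcongr
      _ = 4 := by norm_num
  have hmain := measure_mul_lintegral_enorm_sq_le (u := v - w) (hv1.sub hw1) (hv2.sub hw2) hQm hQd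
    ENNReal.ofReal_ne_top hQv
    ((Function.support_sub v w).trans (union_subset hv3 hw3) |>.trans hQc) hB.1 hQB hBr
  have hsum : ∑ k, ‖∫ x in Q k, (v - w) x‖ₑ ^ 2 ≤ ENNReal.ofReal (Fintype.card ι * η ^ 2) := by
    calc ∑ k, ‖∫ x in Q k, (v - w) x‖ₑ ^ 2 ≤ ∑ _k : ι, ENNReal.ofReal (η ^ 2) := by
          refine Finset.sum_le_sum fun k _ => ?_
          have h1 : ∫ x in Q k, (v - w) x = φ v k - φ w k :=
            integral_sub (hv1.continuous.integrable_of_hasCompactSupport hv2).integrableOn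
              (hw1.continuous.integrable_of_hasCompactSupport hw2).integrableOn
          rw [h1, ← ofReal_norm, ← ENNReal.ofReal_pow (norm_nonneg _)]
          refine ENNReal.ofReal_le_ofReal ?_
          gcongr
          rw [← dist_eq_norm]
          exact (dist_le_pi_dist _ _ k).trans hvw.le
      _ = _ := by
          rw [Finset.sum_const, nsmul_eq_mul, Finset.card_univ, ENNReal.ofReal_mul (by positivity),
            ENNReal.ofReal_natCast]
  have hδ2 : ENNReal.ofReal (δ ^ 2) ≠ 0 := by simpa using hδ.ne'
  refine (ENNReal.mul_le_mul_iff_right hδ2 ENNReal.ofReal_ne_top).1 (hmain.trans ?_)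
  calc _ ≤ 2 * ENNReal.ofReal (Fintype.card ι * η ^ 2) +
        2 * (ENNReal.ofReal (4 * δ ^ 2) * (ENNReal.ofReal (2 * δ) ^ 2 * 4)) := by
        rw [hBv]; gcongr
    _ = ENNReal.ofReal (2 * (Fintype.card ι * η ^ 2) + δ ^ 2 * (128 * δ ^ 2)) := by
        rw [ENNReal.ofReal_add (by positivity) (by positivity),
          ← ENNReal.ofReal_pow (by positivity)]
        have h2 : (2 : ℝ≥0∞) = ENNReal.ofReal 2 := by norm_num
        have h4 : (4 : ℝ≥0∞) = ENNReal.ofReal 4 := by norm_num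
        rw [h2, h4, ← ENNReal.ofReal_mul (by positivity), ← ENNReal.ofReal_mul (by positivity),
          ← ENNReal.ofReal_mul (by positivity), ← ENNReal.ofReal_mul (by positivity)]
        congr 2; ring
    _ ≤ ENNReal.ofReal (δ ^ 2 * ε) := by
        refine ENNReal.ofReal_le_ofReal ?_
        nlinarith [sq_nonneg δ]
    _ = _ := ENNReal.ofReal_mul (by positivity)

/-! ### Test fields, and Friedrichs' inequality on the fixed domain -/

section SquareIntegrable

variable {α E : Type*} [MeasurableSpace α] {μ : Measure α} [NormedAddCommGroup E]

theorem eLpNorm_two_sq (f : α → E) : eLpNorm f 2 μ ^ 2 = ∫⁻ x, ‖f x‖ₑ ^ 2 ∂μ := by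
  have h := eLpNorm_nnreal_pow_eq_lintegral (f := f) (μ := μ) (p := 2) (by norm_num)
  norm_num at h
  exact h

theorem MeasureTheory.Lp.enorm_sq_eq_lintegral (f : Lp E 2 μ) {u : α → E} (hu : f =ᵐ[μ] u) :
    ‖f‖ₑ ^ 2 = ∫⁻ x, ‖u x‖ₑ ^ 2 ∂μ := by
  rw [Lp.enorm_def, eLpNorm_congr_ae hu, eLpNorm_two_sq]

theorem MeasureTheory.MemLp.lintegral_enorm_sq_lt_top {f : α → E} (hf : MemLp f 2 μ) :
    ∫⁻ x, ‖f x‖ₑ ^ 2 ∂μ < ⊤ := by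
  rw [← eLpNorm_two_sq]
  exact ENNReal.pow_lt_top hf.eLpNorm_lt_top

end SquareIntegrable

theorem ContinuousLinearMap.apply_eq_sum_single (A : Plane →L[ℝ] Plane) (z : Plane) :
    A z = ∑ k, z k • A (EuclideanSpace.single k 1) := by
  conv_lhs => rw [← (EuclideanSpace.basisFun (Fin 2) ℝ).sum_repr z]
  simp

/-- The operator norm of the derivative is at most the Frobenius norm of the gradient. -/
theorem enorm_fderiv_le_gradField (u : Plane → Plane) (x : Plane) :
    ‖fderiv ℝ u x‖ₑ ≤ ‖gradField u x‖ₑ := by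
  rw [← ofReal_norm, ← ofReal_norm]
  refine ENNReal.ofReal_le_ofReal (ContinuousLinearMap.opNorm_le_bound _ (norm_nonneg _) fun h => ?_)
  refine (abs_le_of_sq_le_sq' ?_ (by positivity)).2
  rw [mul_pow, EuclideanSpace.norm_sq_eq, EuclideanSpace.norm_sq_eq, EuclideanSpace.norm_sq_eq,
    ContinuousLinearMap.apply_eq_sum_single, Fintype.sum_prod_type]
  simp only [gradField, Fin.sum_univ_two, Real.norm_eq_abs, sq_abs, PiLp.add_apply, PiLp.smul_apply,
    smul_eq_mul]
  generalize (fderiv ℝ u x) (EuclideanSpace.single 0 1) 0 = a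
  generalize (fderiv ℝ u x) (EuclideanSpace.single 1 1) 0 = b
  generalize (fderiv ℝ u x) (EuclideanSpace.single 0 1) 1 = c
  generalize (fderiv ℝ u x) (EuclideanSpace.single 1 1) 1 = d
  nlinarith [sq_nonneg (a * h 1 - b * h 0), sq_nonneg (c * h 1 - d * h 0)]

/-- The test fields `solenoidalTest D` as a vector space. -/
def solenoidalSubmodule (D : Set Plane) : Submodule ℝ (Plane → Plane) where
  carrier := solenoidalTest D
  zero_mem' := by
    refine ⟨contDiff_const, HasCompactSupport.zero, by simp [tsupport], fun x => ?_⟩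
    simp [divField]
  add_mem' := by
    rintro u v ⟨hu1, hu2, hu3, hu4⟩ ⟨hv1, hv2, hv3, hv4⟩
    refine ⟨hu1.add hv1, hu2.add hv2,
      (tsupport_add u v).trans (union_subset hu3 hv3), fun x => ?_⟩
    have hu5 := hu4 x
    have hv5 := hv4 x
    simp only [divField, Fin.sum_univ_two] at hu5 hv5 ⊢
    rw [fderiv_add (hu1.differentiable (by simp) x) (hv1.differentiable (by simp) x)]
    simp only [add_apply, PiLp.add_apply]
    linarith
  smul_mem' := by
    rintro c u ⟨hu1, hu2, hu3, hu4⟩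
    refine ⟨contDiff_const.smul hu1, hu2.smul_left (f := fun _ => c),
      (tsupport_smul_subset_right (fun _ => c) u).trans hu3, fun x => ?_⟩
    have hu5 := hu4 x
    simp only [divField, Fin.sum_univ_two] at hu5 ⊢
    rw [fderiv_const_smul (hu1.differentiable (by simp) x)]
    simp only [smul_apply, PiLp.smul_apply, smul_eq_mul]
    linear_combination c * hu5

theorem gradField_continuous {u : Plane → Plane} (hu : ContDiff ℝ ∞ u) :
    Continuous (gradField u) := by
  have := hu.continuous_fderiv (by simp)
  unfold gradField
  fun_prop

theorem gradField_hasCompactSupport {u : Plane → Plane} (hu : HasCompactSupport u) :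
    HasCompactSupport (gradField u) := by
  refine (hu.fderiv ℝ).mono' (fun x hx => subset_closure ?_)
  simp only [Function.mem_support] at hx ⊢
  contrapose! hx
  unfold gradField
  rw [hx]
  rfl

theorem memLp_of_mem_solenoidalTest {D : Set Plane} {u : Plane → Plane}
    (hu : u ∈ solenoidalTest D) : MemLp u 2 volume ∧ MemLp (gradField u) 2 volume :=
  ⟨hu.1.continuous.memLp_of_hasCompactSupport hu.2.1,
    (gradField_continuous hu.1).memLp_of_hasCompactSupport (gradField_hasCompactSupport hu.2.1)⟩

theorem exists_mem_span_image_Iio {F : Type*} [AddCommGroup F] [Module ℝ F] {e : ℕ → F} {s : F}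
    (hs : s ∈ Submodule.span ℝ (range e)) : ∃ n, s ∈ Submodule.span ℝ (e '' Iio n) := by
  have hmono : ∀ {m n : ℕ}, m ≤ n → Submodule.span ℝ (e '' Iio m) ≤ Submodule.span ℝ (e '' Iio n) :=
    fun h => Submodule.span_mono (image_mono (Iio_subset_Iio h))
  induction hs using Submodule.span_induction with
  | mem x hx =>
    obtain ⟨k, rfl⟩ := hx
    exact ⟨k + 1, Submodule.subset_span (mem_image_of_mem e (Nat.lt_succ_self k))⟩
  | zero => exact ⟨0, zero_mem _⟩
  | add x y _ _ hx hy =>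
    obtain ⟨m, hm⟩ := hx
    obtain ⟨n, hn⟩ := hy
    exact ⟨max m n, add_mem (hmono (le_max_left _ _) hm) (hmono (le_max_right _ _) hn)⟩
  | smul c x _ hx =>
    obtain ⟨m, hm⟩ := hx
    exact ⟨m, Submodule.smul_mem _ c hm⟩

theorem IsGalerkinSequence.exists_span_close {D₀ : Set Plane} {e : ℕ → Plane → Plane}
    (he : IsGalerkinSequence D₀ e) {w : Plane → Plane} (hw : w ∈ solenoidalTest D₀)
    {ε : ℝ} (hε : 0 < ε) :
    ∃ s ∈ Submodule.span ℝ (range e), ∫⁻ x, ‖w x - s x‖ₑ ^ 2 ≤ ENNReal.ofReal ε := by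
  obtain ⟨h1, h2⟩ := memLp_of_mem_solenoidalTest hw
  have hmem : (h1.toLp w, h2.toLp (gradField w)) ∈ gradGraph (solenoidalTest D₀) :=
    ⟨w, hw, h1.coeFn_toLp, h2.coeFn_toLp⟩
  obtain ⟨p, ⟨s, hs, hps, -⟩, hp⟩ := Metric.mem_closure_iff.1 (he.total hmem) (Real.sqrt ε)
    (Real.sqrt_pos.2 hε)
  refine ⟨s, hs, ?_⟩
  have h3 : ((h1.toLp w - p.1 : L2Field) : Plane → Plane) =ᵐ[volume] fun x => w x - s x := by
    filter_upwards [Lp.coeFn_sub (h1.toLp w) p.1, h1.coeFn_toLp, hps] with x hx1 hx2 hx3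
    rw [hx1, Pi.sub_apply, hx2, hx3]
  rw [← Lp.enorm_sq_eq_lintegral _ h3, ← ofReal_norm, ← ENNReal.ofReal_pow (norm_nonneg _)]
  refine ENNReal.ofReal_le_ofReal ?_
  have h4 : ‖h1.toLp w - p.1‖ ≤ Real.sqrt ε := by
    rw [← dist_eq_norm]
    exact (le_max_left _ _).trans hp.le
  calc _ ≤ Real.sqrt ε ^ 2 := by gcongr
    _ = ε := Real.sq_sqrt hε.le

/-- Friedrichs' inequality on the fixed domain: the span of finitely many members of a
Galerkin sequence approximates all test fields in `L²`, uniformly on bounded sets of `H¹₀`. -/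
theorem IsGalerkinSequence.exists_uniform_approx {D₀ : Set Plane} (hD₀ : Bornology.IsBounded D₀)
    {e : ℕ → Plane → Plane} (he : IsGalerkinSequence D₀ e) {ε : ℝ} (hε : 0 < ε) :
    ∃ n : ℕ, ∀ v ∈ solenoidalTest D₀, ∃ s ∈ Submodule.span ℝ (e '' Iio n),
      ∫⁻ x, ‖v x - s x‖ₑ ^ 2 ≤
        ENNReal.ofReal ε * ((∫⁻ x, ‖v x‖ₑ ^ 2) + ∫⁻ x, ‖fderiv ℝ v x‖ₑ ^ 2) := by
  set S : Set (Plane → Plane) := {v | v ∈ solenoidalTest D₀ ∧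
    (∫⁻ x, ‖v x‖ₑ ^ 2) + ∫⁻ x, ‖fderiv ℝ v x‖ₑ ^ 2 ≤ 1} with hS
  obtain ⟨F, hFf, hFS, hF⟩ := exists_finite_net_of_energy_le hD₀ (S := S) (fun v hv =>
    ⟨hv.1.1.of_le (by simp), hv.1.2.1, (subset_tsupport v).trans hv.1.2.2.1,
      le_self_add.trans hv.2, le_add_self.trans hv.2⟩) (ε := ε / 4) (by positivity)
  have hspan : ∀ w : F, ∃ n, ∃ s ∈ Submodule.span ℝ (e '' Iio n),
      ∫⁻ x, ‖w.1 x - s x‖ₑ ^ 2 ≤ ENNReal.ofReal (ε / 4) := fun w => by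
    obtain ⟨s, hs, hws⟩ := he.exists_span_close (hFS w.2).1 (ε := ε / 4) (by positivity)
    obtain ⟨n, hn⟩ := exists_mem_span_image_Iio hs
    exact ⟨n, s, hn, hws⟩
  choose ν σ hσ hσw using hspan
  have := hFf.fintype
  obtain ⟨n, hn⟩ : ∃ n, ∀ w, ν w ≤ n :=
    ⟨Finset.univ.sup ν, fun w => Finset.le_sup (Finset.mem_univ w)⟩
  -- fields of energy at most one
  have hunit : ∀ v ∈ S, ∃ s ∈ Submodule.span ℝ (e '' Iio n),
      ∫⁻ x, ‖v x - s x‖ₑ ^ 2 ≤ ENNReal.ofReal ε := by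
    intro v hv
    obtain ⟨w, hw, hvw⟩ := hF v hv
    refine ⟨σ ⟨w, hw⟩, Submodule.span_mono (image_mono (Iio_subset_Iio (hn _))) (hσ ⟨w, hw⟩), ?_⟩
    have hvc := hv.1.1.continuous
    have hwc := (hFS hw).1.1.continuous
    calc ∫⁻ x, ‖v x - σ ⟨w, hw⟩ x‖ₑ ^ 2
        ≤ ∫⁻ x, (2 * ‖v x - w x‖ₑ ^ 2 + 2 * ‖w x - σ ⟨w, hw⟩ x‖ₑ ^ 2) := by
          refine lintegral_mono fun x => ?_
          rw [← sub_add_sub_cancel (v x) (w x)]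
          exact (pow_le_pow_left' (enorm_add_le _ _) 2).trans (ENNReal.add_sq_le_two _ _)
      _ ≤ 2 * ENNReal.ofReal (ε / 4) + 2 * ENNReal.ofReal (ε / 4) := by
          rw [lintegral_add_left (by fun_prop), lintegral_const_mul' _ _ (by simp),
            lintegral_const_mul' _ _ (by simp)]
          gcongr
          exact hσw ⟨w, hw⟩
      _ = ENNReal.ofReal ε := by
          have h2 : (2 : ℝ≥0∞) = ENNReal.ofReal 2 := by norm_num
          rw [h2, ← ENNReal.ofReal_mul (by positivity),
            ← ENNReal.ofReal_add (by positivity) (by positivity)]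
          congr 1; ring
  refine ⟨n, fun v hv => ?_⟩
  set a := (∫⁻ x, ‖v x‖ₑ ^ 2) + ∫⁻ x, ‖fderiv ℝ v x‖ₑ ^ 2 with ha
  obtain ⟨hv2, hg2⟩ := memLp_of_mem_solenoidalTest hv
  have hatop : a ≠ ⊤ := by
    refine ENNReal.add_ne_top.2 ⟨hv2.lintegral_enorm_sq_lt_top.ne,
      (lt_of_le_of_lt (lintegral_mono fun x => ?_) hg2.lintegral_enorm_sq_lt_top).ne⟩
    exact pow_le_pow_left' (enorm_fderiv_le_gradField v x) 2
  rcases eq_or_ne a 0 with ha0 | ha0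
  · refine ⟨0, zero_mem _, ?_⟩
    have : ∫⁻ x, ‖v x‖ₑ ^ 2 = 0 := (add_eq_zero.1 (ha.symm.trans ha0)).1
    simp [this]
  -- rescale to energy one
  have hr : 0 < a.toReal := ENNReal.toReal_pos ha0 hatop
  set c : ℝ := Real.sqrt a.toReal with hc
  have hc0 : 0 < c := Real.sqrt_pos.2 hr
  have hca : ‖c‖ₑ ^ 2 = a := by
    rw [← ofReal_norm, ← ENNReal.ofReal_pow (norm_nonneg _), Real.norm_eq_abs, sq_abs,
      Real.sq_sqrt hr.le, ENNReal.ofReal_toReal hatop]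
  have hcne : ‖c⁻¹‖ₑ ^ 2 * a = 1 := by
    rw [← hca, ← mul_pow, ← enorm_mul, inv_mul_cancel₀ hc0.ne']; simp
  have hcv : c⁻¹ • v ∈ S := by
    refine ⟨(solenoidalSubmodule D₀).smul_mem c⁻¹ hv, ?_⟩
    have h1 : ∀ x, fderiv ℝ (c⁻¹ • v) x = c⁻¹ • fderiv ℝ v x := fun x =>
      fderiv_const_smul (hv.1.differentiable (by simp) x) _
    simp_rw [h1, Pi.smul_apply, enorm_smul, mul_pow]
    rw [lintegral_const_mul' _ _ (by simp), lintegral_const_mul' _ _ (by simp), ← mul_add, ← ha,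
      hcne]
  obtain ⟨s, hs, hvs⟩ := hunit _ hcv
  refine ⟨c • s, Submodule.smul_mem _ c hs, ?_⟩
  calc ∫⁻ x, ‖v x - (c • s) x‖ₑ ^ 2 = ∫⁻ x, ‖c‖ₑ ^ 2 * ‖(c⁻¹ • v) x - s x‖ₑ ^ 2 := by
        refine lintegral_congr fun x => ?_
        rw [← mul_pow, ← enorm_smul, smul_sub, Pi.smul_apply, Pi.smul_apply, smul_inv_smul₀ hc0.ne']
    _ ≤ a * ENNReal.ofReal ε := by
        rw [lintegral_const_mul' _ _ (by simp), hca]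
        gcongr
    _ = _ := mul_comm _ _

/-! ### The Schmidt process in a Hilbert space -/

section Schmidt

variable {X : Type*} [NormedAddCommGroup X] [InnerProductSpace ℝ X]

/-- Pairwise orthogonal vectors, each of them a unit vector or zero (the second condition says that
`‖W i‖² = 1` unless all `inner ℝ u (W i)` vanish). This is what the Schmidt
process makes of an arbitrary sequence; the zero vectors come from linear dependence. -/
structure IsOrthonormalOrZero (W : ℕ → X) : Prop where
  inner_eq_zero : ∀ i j, i ≠ j → inner ℝ (W i) (W j) = 0
  inner_mul_self : ∀ (u : X) i, inner ℝ u (W i) * inner ℝ (W i) (W i) = inner ℝ u (W i)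

namespace IsOrthonormalOrZero

variable {W : ℕ → X}

theorem norm_le_one (hW : IsOrthonormalOrZero W) (i : ℕ) : ‖W i‖ ≤ 1 := by
  have h := hW.inner_mul_self (W i) i
  rw [real_inner_self_eq_norm_sq] at h
  nlinarith [norm_nonneg (W i), sq_nonneg (‖W i‖ ^ 2 - 1), sq_nonneg (‖W i‖ - 1)]

theorem norm_sum_smul_sq (hW : IsOrthonormalOrZero W) (u : X) (n : ℕ) :
    ‖∑ i ∈ Finset.range n, inner ℝ u (W i) • W i‖ ^ 2 =
      ∑ i ∈ Finset.range n, inner ℝ u (W i) ^ 2 := by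
  rw [← real_inner_self_eq_norm_sq, sum_inner]
  refine Finset.sum_congr rfl fun i hi => ?_
  rw [inner_sum, Finset.sum_eq_single_of_mem i hi]
  · rw [real_inner_smul_left, real_inner_smul_right, hW.inner_mul_self u i, sq]
  · intro j _ hj
    rw [real_inner_smul_left, real_inner_smul_right, hW.inner_eq_zero i j hj.symm]
    ring

theorem inner_sub_sum_smul (hW : IsOrthonormalOrZero W) (u : X) {n j : ℕ} (hj : j < n) :
    inner ℝ (u - ∑ i ∈ Finset.range n, inner ℝ u (W i) • W i) (W j) = 0 := by
  rw [inner_sub_left, sum_inner, Finset.sum_eq_single_of_mem j (Finset.mem_range.2 hj)]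
  · rw [real_inner_smul_left, hW.inner_mul_self u j, sub_self]
  · intro i _ hi
    rw [real_inner_smul_left, hW.inner_eq_zero _ _ hi, mul_zero]

theorem inner_sub_sum_smul_of_mem_span (hW : IsOrthonormalOrZero W) (u : X) {n : ℕ} {v : X}
    (hv : v ∈ Submodule.span ℝ (W '' Iio n)) :
    inner ℝ (u - ∑ i ∈ Finset.range n, inner ℝ u (W i) • W i) v = 0 := by
  induction hv using Submodule.span_induction with
  | mem x hx =>
    obtain ⟨j, hj, rfl⟩ := hx
    exact hW.inner_sub_sum_smul u hj
  | zero => exact inner_zero_right _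
  | add x y _ _ hx hy => rw [inner_add_right, hx, hy, add_zero]
  | smul c x _ hx => rw [real_inner_smul_right, hx, mul_zero]

theorem sum_smul_mem_span (W : ℕ → X) (u : X) (n : ℕ) :
    ∑ i ∈ Finset.range n, inner ℝ u (W i) • W i ∈ Submodule.span ℝ (W '' Iio n) :=
  Submodule.sum_mem _ fun _ hi => Submodule.smul_mem _ _
    (Submodule.subset_span (mem_image_of_mem W (Finset.mem_range.1 hi)))

theorem norm_sub_sum_smul_sq (hW : IsOrthonormalOrZero W) (u : X) (n : ℕ) :
    ‖u - ∑ i ∈ Finset.range n, inner ℝ u (W i) • W i‖ ^ 2 =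
      ‖u‖ ^ 2 - ∑ i ∈ Finset.range n, inner ℝ u (W i) ^ 2 := by
  have h1 := hW.inner_sub_sum_smul_of_mem_span u (sum_smul_mem_span W u n)
  have h2 := hW.norm_sum_smul_sq u n
  set p := ∑ i ∈ Finset.range n, inner ℝ u (W i) • W i
  rw [inner_sub_left, real_inner_self_eq_norm_sq] at h1
  rw [norm_sub_sq_real]
  linarith

theorem norm_sq_sub_le (hW : IsOrthonormalOrZero W) (u : X) {n : ℕ} {v : X}
    (hv : v ∈ Submodule.span ℝ (W '' Iio n)) :
    ‖u‖ ^ 2 - ∑ i ∈ Finset.range n, inner ℝ u (W i) ^ 2 ≤ ‖u - v‖ ^ 2 := by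
  have h1 := hW.inner_sub_sum_smul_of_mem_span u (sub_mem (sum_smul_mem_span W u n) hv)
  have h2 := norm_add_sq_real (u - ∑ i ∈ Finset.range n, inner ℝ u (W i) • W i)
    (∑ i ∈ Finset.range n, inner ℝ u (W i) • W i - v)
  rw [h1, sub_add_sub_cancel, hW.norm_sub_sum_smul_sq] at h2
  nlinarith [sq_nonneg ‖∑ i ∈ Finset.range n, inner ℝ u (W i) • W i - v‖]

/-- Two vectors are close if both are close to the span of finitely many members of the family
and their coefficients with respect to these are close. -/
theorem norm_sub_sq_le (hW : IsOrthonormalOrZero W) (u v : X) (n : ℕ) :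
    ‖u - v‖ ^ 2 ≤ 3 * ((‖u‖ ^ 2 - ∑ i ∈ Finset.range n, inner ℝ u (W i) ^ 2) +
      (‖v‖ ^ 2 - ∑ i ∈ Finset.range n, inner ℝ v (W i) ^ 2) +
      ∑ i ∈ Finset.range n, (inner ℝ u (W i) - inner ℝ v (W i)) ^ 2) := by
  rw [← hW.norm_sub_sum_smul_sq u, ← hW.norm_sub_sum_smul_sq v]
  simp_rw [← inner_sub_left]
  rw [← hW.norm_sum_smul_sq (u - v)]
  set a := u - ∑ i ∈ Finset.range n, inner ℝ u (W i) • W i with ha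
  set b := v - ∑ i ∈ Finset.range n, inner ℝ v (W i) • W i with hb
  set c := ∑ i ∈ Finset.range n, inner ℝ (u - v) (W i) • W i with hc
  have h1 : u - v = a - b + c := by
    rw [ha, hb, hc]
    simp_rw [inner_sub_left, sub_smul]
    rw [Finset.sum_sub_distrib]
    abel
  have h2 : ‖u - v‖ ≤ ‖a‖ + ‖b‖ + ‖c‖ := by
    rw [h1]
    exact (norm_add_le _ _).trans (by gcongr; exact norm_sub_le _ _)
  nlinarith [norm_nonneg (u - v), sq_nonneg (‖a‖ - ‖b‖), sq_nonneg (‖a‖ - ‖c‖),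
    sq_nonneg (‖b‖ - ‖c‖)]

end IsOrthonormalOrZero

theorem schmidt_eq {F : Type*} [AddCommGroup F] [Module ℝ F] (B : F → F → ℝ) (e : ℕ → F) (n : ℕ) :
    schmidt B e n =
      (Real.sqrt (B (e n - ∑ i : Fin n, B (e n) (schmidt B e i) • schmidt B e i)
        (e n - ∑ i : Fin n, B (e n) (schmidt B e i) • schmidt B e i)))⁻¹ •
        (e n - ∑ i : Fin n, B (e n) (schmidt B e i) • schmidt B e i) := by
  rw [schmidt]

theorem isOrthonormalOrZero_schmidt (E : ℕ → X) :
    IsOrthonormalOrZero (schmidt (fun u v : X => inner ℝ u v) E) := by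
  set W := schmidt (fun u v : X => inner ℝ u v) E with hW
  have hself : ∀ (u : X) i, inner ℝ u (W i) * inner ℝ (W i) (W i) = inner ℝ u (W i) := by
    intro u i
    rw [hW, schmidt_eq, ← hW]
    set v := E i - ∑ j : Fin i, inner ℝ (E i) (W j) • W j
    simp only [real_inner_smul_right, real_inner_self_eq_norm_sq,
      Real.sqrt_sq (norm_nonneg v), norm_smul, norm_inv, norm_norm]
    rcases eq_or_ne v 0 with h | h
    · simp [h]
    · have := norm_ne_zero_iff.2 h
      field_simp
  have hlt : ∀ n, ∀ i < n, inner ℝ (W n) (W i) = 0 := by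
    intro n
    induction n using Nat.strong_induction_on with
    | _ n ih =>
      intro i hi
      have hv : inner ℝ (E n - ∑ j : Fin n, inner ℝ (E n) (W j) • W j) (W i) = 0 := by
        rw [inner_sub_left, sum_inner,
          Finset.sum_eq_single_of_mem (⟨i, hi⟩ : Fin n) (Finset.mem_univ _)]
        · rw [real_inner_smul_left, hself, sub_self]
        · intro j _ hj
          have hji : (j : ℕ) ≠ i := fun h => hj (Fin.ext h)
          rw [real_inner_smul_left]
          rcases hji.lt_or_gt with h | h
          · rw [real_inner_comm (W i) (W j), ih i hi j h, mul_zero]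
          · rw [ih j j.2 i h, mul_zero]
      rw [hW, schmidt_eq, ← hW, real_inner_smul_left, hv, mul_zero]
  refine ⟨fun i j hij => ?_, hself⟩
  rcases hij.lt_or_gt with h | h
  · rw [real_inner_comm]; exact hlt j i h
  · exact hlt i j h

theorem span_image_Iio_le_span_schmidt (E : ℕ → X) (n : ℕ) :
    Submodule.span ℝ (E '' Iio n) ≤
      Submodule.span ℝ (schmidt (fun u v : X => inner ℝ u v) E '' Iio n) := by
  set W := schmidt (fun u v : X => inner ℝ u v) E with hW
  rw [Submodule.span_le]
  rintro _ ⟨k, hk, rfl⟩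
  have hk' : k < n := hk
  set v := E k - ∑ j : Fin k, inner ℝ (E k) (W j) • W j with hv
  have h1 : W k = (Real.sqrt (inner ℝ v v))⁻¹ • v := by
    rw [hW, schmidt_eq]
  have h2 : E k = ‖v‖ • W k + ∑ j : Fin k, inner ℝ (E k) (W j) • W j := by
    rw [h1, real_inner_self_eq_norm_sq, Real.sqrt_sq (norm_nonneg v), smul_smul]
    rcases eq_or_ne v 0 with h | h
    · rw [h, smul_zero, zero_add]; exact sub_eq_zero.1 (hv.symm.trans h)
    · rw [mul_inv_cancel₀ (norm_ne_zero_iff.2 h), one_smul, hv, sub_add_cancel]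
  have hmem : ∀ i < n, W i ∈ Submodule.span ℝ (W '' Iio n) := fun i hi =>
    Submodule.subset_span (mem_image_of_mem W hi)
  rw [SetLike.mem_coe, h2]
  exact add_mem (Submodule.smul_mem _ _ (hmem k hk'))
    (Submodule.sum_mem _ fun j _ => Submodule.smul_mem _ _ (hmem j (j.2.trans hk')))

/-- A linear map that carries a form `B` to the inner product carries the Schmidt
process for `B` to the one for the inner product. -/
theorem map_schmidt {F : Type*} [AddCommGroup F] [Module ℝ F] {S : Submodule ℝ F} (τ : S →ₗ[ℝ] X)
    {B : F → F → ℝ} (hB : ∀ u v : S, B u v = inner ℝ (τ u) (τ v)) {e : ℕ → F}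
    (he : ∀ n, e n ∈ S) (n : ℕ) :
    ∃ h : schmidt B e n ∈ S, τ ⟨schmidt B e n, h⟩ =
      schmidt (fun u v : X => inner ℝ u v) (fun n => τ ⟨e n, he n⟩) n := by
  induction n using Nat.strong_induction_on with
  | _ n ih =>
    choose hS hτ using ih
    set v : S := ⟨e n, he n⟩ - ∑ i : Fin n,
      B (e n) (schmidt B e i) • (⟨schmidt B e i, hS i i.2⟩ : S) with hv
    have hvF : (v : F) = e n - ∑ i : Fin n, B (e n) (schmidt B e i) • schmidt B e i := by
      rw [hv]; simp
    have hvX : τ v = τ ⟨e n, he n⟩ - ∑ i : Fin n, inner ℝ (τ ⟨e n, he n⟩)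
        (schmidt (fun u v : X => inner ℝ u v) (fun n => τ ⟨e n, he n⟩) i) •
        schmidt (fun u v : X => inner ℝ u v) (fun n => τ ⟨e n, he n⟩) i := by
      rw [hv, map_sub, map_sum]
      congr 1
      refine Finset.sum_congr rfl fun i _ => ?_
      rw [map_smul, hτ i i.2, ← hτ i i.2, ← hB, hτ i i.2]
    have hn : schmidt B e n = ((Real.sqrt (B v v))⁻¹ • v : S) := by
      rw [schmidt_eq, ← hvF]; simp
    refine ⟨hn ▸ Subtype.property _, ?_⟩
    have hn' : (⟨schmidt B e n, hn ▸ Subtype.property _⟩ : S) = (Real.sqrt (B v v))⁻¹ • v :=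
      Subtype.ext hn
    rw [hn', map_smul, schmidt_eq, ← hvX, hB]

end Schmidt

/-! ### The divergence in weak form -/

/-- The divergence theorem for a compactly supported field, tested against a function. -/
theorem integral_mul_divField {w : Plane → Plane} (hw : ContDiff ℝ 1 w) (hc : HasCompactSupport w)
    {φ : Plane → ℝ} (hφ : ContDiff ℝ 1 φ) :
    ∫ x, φ x * divField w x = -∫ x, fderiv ℝ φ x (w x) := by
  have hwi : ∀ i : Fin 2, ContDiff ℝ 1 fun x => w x i := fun i => by fun_prop
  have hci : ∀ i : Fin 2, HasCompactSupport fun x => w x i := fun i =>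
    hc.comp_left (g := fun z : Plane => z i) rfl
  have hdi : ∀ i x, fderiv ℝ (fun x => w x i) x (EuclideanSpace.single i 1) =
      fderiv ℝ w x (EuclideanSpace.single i 1) i := fun i x => by
    have h1 := ((EuclideanSpace.proj i : Plane →L[ℝ] ℝ).hasFDerivAt).comp x
      (hw.differentiable one_ne_zero x).hasFDerivAt
    have h2 : (fun x => w x i) = (EuclideanSpace.proj i : Plane →L[ℝ] ℝ) ∘ w := rfl
    rw [h2, h1.fderiv]
    rfl
  have hfw : ∀ i, Continuous fun x => fderiv ℝ (fun x => w x i) x (EuclideanSpace.single i 1) :=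
    fun i => ((hwi i).continuous_fderiv one_ne_zero).clm_apply continuous_const
  have hfφ : ∀ i : Fin 2, Continuous fun x => fderiv ℝ φ x (EuclideanSpace.single i 1) :=
    fun i => (hφ.continuous_fderiv one_ne_zero).clm_apply continuous_const
  have hfc : ∀ i, HasCompactSupport
      fun x => fderiv ℝ (fun x => w x i) x (EuclideanSpace.single i 1) :=
    fun i => (hci i).fderiv_apply ℝ _
  have hI1 : ∀ i, Integrable fun x =>
      φ x * fderiv ℝ (fun x => w x i) x (EuclideanSpace.single i 1) := fun i =>
    (hφ.continuous.mul (hfw i)).integrable_of_hasCompactSupport (hfc i).mul_left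
  have hI2 : ∀ i : Fin 2, Integrable fun x =>
      fderiv ℝ φ x (EuclideanSpace.single i 1) * w x i := fun i =>
    ((hfφ i).mul (hwi i).continuous).integrable_of_hasCompactSupport (hci i).mul_left
  have hI3 : ∀ i : Fin 2, Integrable fun x => φ x * w x i := fun i =>
    (hφ.continuous.mul (hwi i).continuous).integrable_of_hasCompactSupport (hci i).mul_left
  have hparts : ∀ i, ∫ x, φ x * fderiv ℝ (fun x => w x i) x (EuclideanSpace.single i 1) =
      -∫ x, fderiv ℝ φ x (EuclideanSpace.single i 1) * w x i := fun i =>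
    integral_mul_fderiv_eq_neg_fderiv_mul_of_integrable (hI2 i) (hI1 i) (hI3 i)
      (fun x _ => hφ.differentiable one_ne_zero x) (fun x _ => (hwi i).differentiable one_ne_zero x)
  have h1 : ∀ x, φ x * divField w x =
      ∑ i, φ x * fderiv ℝ (fun x => w x i) x (EuclideanSpace.single i 1) := fun x => by
    rw [divField, Finset.mul_sum]
    simp_rw [hdi]
  have h2 : ∀ x, fderiv ℝ φ x (w x) =
      ∑ i, fderiv ℝ φ x (EuclideanSpace.single i 1) * w x i := fun x => by
    conv_lhs => rw [← (EuclideanSpace.basisFun (Fin 2) ℝ).sum_repr (w x)]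
    simp [mul_comm]
  simp_rw [h1, h2]
  rw [integral_finsetSum _ fun i _ => hI1 i, integral_finsetSum _ fun i _ => hI2 i,
    ← Finset.sum_neg_distrib]
  exact Finset.sum_congr rfl fun i _ => hparts i

theorem divField_continuous {w : Plane → Plane} (hw : ContDiff ℝ 1 w) :
    Continuous (divField w) := by
  have := hw.continuous_fderiv one_ne_zero
  unfold divField
  fun_prop

/-- A field that is divergence free in the weak sense is so pointwise. -/
theorem divField_eq_zero_of_weak {w : Plane → Plane} (hw : ContDiff ℝ 1 w)
    (hc : HasCompactSupport w)
    (h : ∀ φ : Plane → ℝ, ContDiff ℝ ∞ φ → ∫ x, fderiv ℝ φ x (w x) = 0) (x : Plane) :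
    divField w x = 0 := by
  have hcont := divField_continuous hw
  have h0 : divField w =ᵐ[volume] fun _ => 0 :=
    ae_eq_zero_of_integral_contDiff_smul_eq_zero hcont.locallyIntegrable fun φ hφ _ => by
      simp_rw [smul_eq_mul]
      rw [integral_mul_divField hw hc (hφ.of_le (by simp)), h φ hφ, neg_zero]
  exact congrFun ((hcont.ae_eq_iff_eq volume continuous_const).1 h0) x

/-! ### Transport of divergence free fields along a change of coordinates -/

/-- Mutually inverse smooth coordinate changes `ξ : D₀ → D` and `η : D → D₀` of open sets, the
Jacobian determinant of `ξ` being a positive constant `J`. The values of `ξ` outside of `D₀` and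
of `η` outside of `D` play no role. -/
structure IsCoordChange (D D₀ : Set Plane) (ξ η : Plane → Plane) (J : ℝ) : Prop where
  isOpen : IsOpen D
  isOpen₀ : IsOpen D₀
  contDiff_xi : ContDiff ℝ ∞ ξ
  contDiff_eta : ContDiff ℝ ∞ η
  mapsTo_xi : MapsTo ξ D₀ D
  mapsTo_eta : MapsTo η D D₀
  eta_xi : ∀ y ∈ D₀, η (ξ y) = y
  xi_eta : ∀ x ∈ D, ξ (η x) = x
  J_pos : 0 < J
  det_eta : ∀ x ∈ D, (fderiv ℝ η x).det = J⁻¹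

/-- The transport of the field `v` along `ξ` (with inverse `η` on `D`) as a vector field,
`x ↦ Dξ(η x) v(η x)` on `D`, extended by zero. -/
noncomputable def transportField (D : Set Plane) (ξ η : Plane → Plane) (v : Plane → Plane) :
    Plane → Plane :=
  indicator D fun x => fderiv ℝ ξ (η x) (v (η x))

namespace IsCoordChange

variable {D D₀ : Set Plane} {ξ η : Plane → Plane} {J : ℝ}

theorem fderiv_eta_xi (h : IsCoordChange D D₀ ξ η J) {y : Plane} (hy : y ∈ D₀) :
    (fderiv ℝ η (ξ y)).comp (fderiv ℝ ξ y) = ContinuousLinearMap.id ℝ Plane := by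
  have h1 := ((h.contDiff_eta.differentiable (by simp)) (ξ y)).hasFDerivAt.comp y
    ((h.contDiff_xi.differentiable (by simp)) y).hasFDerivAt
  have h2 : η ∘ ξ =ᶠ[nhds y] id := by
    filter_upwards [h.isOpen₀.mem_nhds hy] with z hz using h.eta_xi z hz
  exact (h1.congr_of_eventuallyEq h2.symm).unique (hasFDerivAt_id y)

theorem fderiv_xi_eta (h : IsCoordChange D D₀ ξ η J) {x : Plane} (hx : x ∈ D) :
    (fderiv ℝ ξ (η x)).comp (fderiv ℝ η x) = ContinuousLinearMap.id ℝ Plane := by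
  have h1 := ((h.contDiff_xi.differentiable (by simp)) (η x)).hasFDerivAt.comp x
    ((h.contDiff_eta.differentiable (by simp)) x).hasFDerivAt
  have h2 : ξ ∘ η =ᶠ[nhds x] id := by
    filter_upwards [h.isOpen.mem_nhds hx] with z hz using h.xi_eta z hz
  exact (h1.congr_of_eventuallyEq h2.symm).unique (hasFDerivAt_id x)

theorem det_xi (h : IsCoordChange D D₀ ξ η J) {y : Plane} (hy : y ∈ D₀) :
    (fderiv ℝ ξ y).det = J := by
  have h1 := congrArg ContinuousLinearMap.det (h.fderiv_eta_xi hy)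
  have h2 : ((fderiv ℝ η (ξ y)).comp (fderiv ℝ ξ y)).det =
      (fderiv ℝ η (ξ y)).det * (fderiv ℝ ξ y).det := by
    simp only [ContinuousLinearMap.det, ContinuousLinearMap.toLinearMap_comp]
    exact LinearMap.det_comp _ _
  rw [h2, h.det_eta _ (h.mapsTo_xi hy)] at h1
  have h3 : (ContinuousLinearMap.id ℝ Plane).det = 1 := by
    simp [ContinuousLinearMap.det]
  rw [h3] at h1
  have := h.J_pos
  field_simp at h1
  exact h1

theorem symm (h : IsCoordChange D D₀ ξ η J) : IsCoordChange D₀ D η ξ J⁻¹ where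
  isOpen := h.isOpen₀
  isOpen₀ := h.isOpen
  contDiff_xi := h.contDiff_eta
  contDiff_eta := h.contDiff_xi
  mapsTo_xi := h.mapsTo_eta
  mapsTo_eta := h.mapsTo_xi
  eta_xi := h.xi_eta
  xi_eta := h.eta_xi
  J_pos := inv_pos.2 h.J_pos
  det_eta := fun y hy => by rw [h.det_xi hy, inv_inv]

theorem image_xi (h : IsCoordChange D D₀ ξ η J) : ξ '' D₀ = D :=
  Subset.antisymm (image_subset_iff.2 h.mapsTo_xi) fun x hx =>
    ⟨η x, h.mapsTo_eta hx, h.xi_eta x hx⟩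

theorem injOn_xi (h : IsCoordChange D D₀ ξ η J) : InjOn ξ D₀ := fun y hy z hz hyz => by
  rw [← h.eta_xi y hy, ← h.eta_xi z hz, hyz]

theorem setLIntegral_eq (h : IsCoordChange D D₀ ξ η J) (F : Plane → ℝ≥0∞) :
    ∫⁻ x in D, F x = ENNReal.ofReal J * ∫⁻ y in D₀, F (ξ y) := by
  rw [← h.image_xi, lintegral_image_eq_lintegral_abs_det_fderiv_mul volume h.isOpen₀.measurableSet
    (fun y _ => ((h.contDiff_xi.differentiable (by simp)) y).hasFDerivAt.hasFDerivWithinAt)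
    h.injOn_xi, ← lintegral_const_mul' _ _ ENNReal.ofReal_ne_top]
  refine setLIntegral_congr_fun h.isOpen₀.measurableSet fun y hy => ?_
  rw [h.det_xi hy, abs_of_pos h.J_pos]

theorem setIntegral_eq (h : IsCoordChange D D₀ ξ η J) (F : Plane → ℝ) :
    ∫ x in D, F x = J * ∫ y in D₀, F (ξ y) := by
  rw [← h.image_xi, integral_image_eq_integral_abs_det_fderiv_smul volume h.isOpen₀.measurableSet
    (fun y _ => ((h.contDiff_xi.differentiable (by simp)) y).hasFDerivAt.hasFDerivWithinAt)
    h.injOn_xi, ← integral_const_mul]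
  refine setIntegral_congr_fun h.isOpen₀.measurableSet fun y hy => ?_
  rw [h.det_xi hy, abs_of_pos h.J_pos, smul_eq_mul]

theorem transportField_xi (h : IsCoordChange D D₀ ξ η J) (v : Plane → Plane) {y : Plane}
    (hy : y ∈ D₀) : transportField D ξ η v (ξ y) = fderiv ℝ ξ y (v y) := by
  rw [transportField, indicator_of_mem (h.mapsTo_xi hy), h.eta_xi y hy]

theorem support_transportField_subset (h : IsCoordChange D D₀ ξ η J) (v : Plane → Plane) :
    Function.support (transportField D ξ η v) ⊆ ξ '' (tsupport v ∩ D₀) := by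
  intro x hx
  have hxD : x ∈ D := by
    by_contra hxD
    exact hx (indicator_of_notMem hxD _)
  refine ⟨η x, ⟨subset_tsupport v fun h0 => hx ?_, h.mapsTo_eta hxD⟩, h.xi_eta x hxD⟩
  rw [transportField, indicator_of_mem hxD, h0, map_zero]

/-- The transport of a divergence free test field along a coordinate change of constant Jacobian
determinant is a divergence free test field. The divergence vanishes because, after the change of
variables, testing with `∇φ` becomes testing the original field with `∇(φ ∘ ξ)`. -/
theorem transportField_mem (h : IsCoordChange D D₀ ξ η J) {v : Plane → Plane}
    (hv : v ∈ solenoidalTest D₀) : transportField D ξ η v ∈ solenoidalTest D := by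
  obtain ⟨hv1, hv2, hv3, hv4⟩ := hv
  have hK : IsCompact (ξ '' tsupport v) := hv2.isCompact.image h.contDiff_xi.continuous
  have hKD : ξ '' tsupport v ⊆ D := image_subset_iff.2 fun y hy => h.mapsTo_xi (hv3 hy)
  have hsupp : Function.support (transportField D ξ η v) ⊆ ξ '' tsupport v :=
    (h.support_transportField_subset v).trans (image_mono inter_subset_left)
  have hts : tsupport (transportField D ξ η v) ⊆ ξ '' tsupport v :=
    closure_minimal hsupp hK.isClosed
  have hcs : HasCompactSupport (transportField D ξ η v) :=
    HasCompactSupport.of_support_subset_isCompact hK hsupp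
  have hsm : ContDiff ℝ ∞ (transportField D ξ η v) := by
    refine contDiff_iff_contDiffAt.2 fun x => ?_
    by_cases hx : x ∈ D
    · have h1 : ContDiff ℝ ∞ fun x => fderiv ℝ ξ (η x) (v (η x)) :=
        ((h.contDiff_xi.fderiv_right (m := ∞) (by simp)).comp h.contDiff_eta).clm_apply
          (hv1.comp h.contDiff_eta)
      refine h1.contDiffAt.congr_of_eventuallyEq ?_
      filter_upwards [h.isOpen.mem_nhds hx] with z hz using indicator_of_mem hz _
    · refine (contDiffAt_const (c := (0 : Plane))).congr_of_eventuallyEq ?_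
      filter_upwards [hK.isClosed.isOpen_compl.mem_nhds fun hx' => hx (hKD hx')] with z hz
      exact Function.notMem_support.1 fun hz' => hz (hsupp hz')
  refine ⟨hsm, hcs, hts.trans hKD, divField_eq_zero_of_weak (hsm.of_le (by simp)) hcs
    fun φ hφ => ?_⟩
  have hφξ : ContDiff ℝ ∞ (φ ∘ ξ) := hφ.comp h.contDiff_xi
  have h1 : ∫ x in D, fderiv ℝ φ x (transportField D ξ η v x) =
      ∫ x, fderiv ℝ φ x (transportField D ξ η v x) :=
    setIntegral_eq_integral_of_forall_compl_eq_zero fun x hx => by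
      rw [transportField, indicator_of_notMem hx, map_zero]
  have h2 : ∫ y in D₀, fderiv ℝ (φ ∘ ξ) y (v y) = ∫ y, fderiv ℝ (φ ∘ ξ) y (v y) :=
    setIntegral_eq_integral_of_forall_compl_eq_zero fun y hy => by
      rw [Function.notMem_support.1 fun hy' => hy (hv3 (subset_tsupport v hy')), map_zero]
  have h3 : ∫ y, fderiv ℝ (φ ∘ ξ) y (v y) = 0 := by
    have := integral_mul_divField (hv1.of_le (by simp)) hv2 (hφξ.of_le (by simp))
    simp only [hv4, mul_zero, integral_zero] at this
    linarith
  rw [← h1, h.setIntegral_eq, mul_eq_zero, ← h3, ← h2]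
  right
  refine setIntegral_congr_fun h.isOpen₀.measurableSet fun y hy => ?_
  rw [h.transportField_xi v hy, fderiv_comp y ((hφ.differentiable (by simp)) _)
    ((h.contDiff_xi.differentiable (by simp)) _)]
  rfl

theorem transportField_transportField (h : IsCoordChange D D₀ ξ η J) {u : Plane → Plane}
    (hu : Function.support u ⊆ D) : transportField D ξ η (transportField D₀ η ξ u) = u := by
  funext x
  by_cases hx : x ∈ D
  · rw [transportField, indicator_of_mem hx, h.symm.transportField_xi u hx]
    exact congrArg (fun A : Plane →L[ℝ] Plane => A (u x)) (h.fderiv_xi_eta hx)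
  · rw [transportField, indicator_of_notMem hx]
    exact (Function.notMem_support.1 fun hx' => hx (hu hx')).symm

theorem lintegral_transportField_sq_le (h : IsCoordChange D D₀ ξ η J) (v : Plane → Plane)
    {C : ℝ≥0∞} (hC : C ≠ ⊤) (hξ : ∀ y ∈ D₀, ‖fderiv ℝ ξ y‖ₑ ≤ C) :
    ∫⁻ x, ‖transportField D ξ η v x‖ₑ ^ 2 ≤ ENNReal.ofReal J * (C ^ 2 * ∫⁻ y, ‖v y‖ₑ ^ 2) := by
  have h1 : ∫⁻ x in D, ‖transportField D ξ η v x‖ₑ ^ 2 = ∫⁻ x, ‖transportField D ξ η v x‖ₑ ^ 2 := by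
    refine setLIntegral_eq_of_support_subset fun x hx => ?_
    by_contra hxD
    exact hx (by simp [transportField, indicator_of_notMem hxD])
  rw [← h1, h.setLIntegral_eq]
  gcongr
  calc _ ≤ ∫⁻ y in D₀, C ^ 2 * ‖v y‖ₑ ^ 2 := by
        refine setLIntegral_mono' h.isOpen₀.measurableSet fun y hy => ?_
        rw [h.transportField_xi v hy, ← mul_pow]
        refine pow_le_pow_left' ((ContinuousLinearMap.le_opENorm _ _).trans ?_) 2
        gcongr
        exact hξ y hy
    _ = C ^ 2 * ∫⁻ y in D₀, ‖v y‖ₑ ^ 2 := lintegral_const_mul' _ _ (by simp [hC])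
    _ ≤ _ := by gcongr; exact Measure.restrict_le_self

/-- The gradient of a transported test field is controlled by the field and its gradient. -/
theorem lintegral_fderiv_transportField_sq_le (h : IsCoordChange D D₀ ξ η J) {v : Plane → Plane}
    (hv : v ∈ solenoidalTest D₀) {C : ℝ≥0∞} (hC : C ≠ ⊤)
    (hξ : ∀ x ∈ D, ‖fderiv ℝ ξ (η x)‖ₑ ≤ C) (hη : ∀ x ∈ D, ‖fderiv ℝ η x‖ₑ ≤ C)
    (hξη : ∀ x ∈ D, ‖fderiv ℝ (fun x => fderiv ℝ ξ (η x)) x‖ₑ ≤ C) :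
    ∫⁻ x, ‖fderiv ℝ (transportField D ξ η v) x‖ₑ ^ 2 ≤
      ENNReal.ofReal J * (2 * C ^ 2 * (∫⁻ y, ‖v y‖ₑ ^ 2) +
        2 * (C * C) ^ 2 * ∫⁻ y, ‖fderiv ℝ v y‖ₑ ^ 2) := by
  have hw := h.transportField_mem hv
  have hpt : ∀ x ∈ D, ‖fderiv ℝ (transportField D ξ η v) x‖ₑ ≤
      C * ‖v (η x)‖ₑ + C * C * ‖fderiv ℝ v (η x)‖ₑ := by
    intro x hx
    have h1 : transportField D ξ η v =ᶠ[nhds x] fun x => fderiv ℝ ξ (η x) (v (η x)) := by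
      filter_upwards [h.isOpen.mem_nhds hx] with z hz using indicator_of_mem hz _
    have hA : DifferentiableAt ℝ (fun x => fderiv ℝ ξ (η x)) x :=
      ((h.contDiff_xi.fderiv_right (m := ∞) (by simp)).comp h.contDiff_eta).differentiable
        (by simp) x
    have hη' : DifferentiableAt ℝ η x := h.contDiff_eta.differentiable (by simp) x
    have hv' : DifferentiableAt ℝ v (η x) := hv.1.differentiable (by simp) _
    have hB : DifferentiableAt ℝ (fun x => v (η x)) x := hv'.comp x hη'
    have hBd : fderiv ℝ (fun x => v (η x)) x = (fderiv ℝ v (η x)).comp (fderiv ℝ η x) :=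
      fderiv_comp x hv' hη'
    rw [h1.fderiv_eq, fderiv_clm_apply hA hB, hBd, add_comm]
    refine (enorm_add_le (E := Plane →L[ℝ] Plane) _ _).trans (add_le_add ?_ ?_)
    · refine ContinuousLinearMap.opENorm_le_bound _ fun z => ?_
      rw [ContinuousLinearMap.flip_apply]
      calc _ ≤ ‖fderiv ℝ (fun x => fderiv ℝ ξ (η x)) x z‖ₑ * ‖v (η x)‖ₑ :=
            ContinuousLinearMap.le_opENorm _ _
        _ ≤ (C * ‖z‖ₑ) * ‖v (η x)‖ₑ := by
            gcongr
            refine (ContinuousLinearMap.le_opENorm _ _).trans ?_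
            gcongr
            exact hξη x hx
        _ = _ := by ring
    · refine ContinuousLinearMap.opENorm_le_bound _ fun z => ?_
      calc _ ≤ ‖fderiv ℝ ξ (η x)‖ₑ * (‖fderiv ℝ v (η x)‖ₑ * (‖fderiv ℝ η x‖ₑ * ‖z‖ₑ)) := by
            have a1 := ContinuousLinearMap.le_opENorm (fderiv ℝ η x) z
            have a2 := ContinuousLinearMap.le_opENorm (fderiv ℝ v (η x)) (fderiv ℝ η x z)
            have a3 := ContinuousLinearMap.le_opENorm (fderiv ℝ ξ (η x))
              (fderiv ℝ v (η x) (fderiv ℝ η x z))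
            exact a3.trans (by gcongr; exact a2.trans (by gcongr))
        _ ≤ C * (‖fderiv ℝ v (η x)‖ₑ * (C * ‖z‖ₑ)) := by
            gcongr
            exacts [hξ x hx, hη x hx]
        _ = _ := by ring
  have h1 : ∫⁻ x in D, ‖fderiv ℝ (transportField D ξ η v) x‖ₑ ^ 2 =
      ∫⁻ x, ‖fderiv ℝ (transportField D ξ η v) x‖ₑ ^ 2 := by
    refine setLIntegral_eq_of_support_subset fun x hx => ?_
    refine hw.2.2.1 (support_fderiv_subset ℝ (f := transportField D ξ η v) fun h0 => hx ?_)
    simp only [h0]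
    exact (pow_eq_zero_iff two_ne_zero).2 (enorm_zero (E := Plane →L[ℝ] Plane))
  have hvm := (hv.1.continuous_fderiv (by simp)).measurable
  have hvc := hv.1.continuous
  rw [← h1]
  calc _ ≤ ∫⁻ x in D, (2 * C ^ 2 * ‖v (η x)‖ₑ ^ 2 + 2 * (C * C) ^ 2 * ‖fderiv ℝ v (η x)‖ₑ ^ 2) := by
        refine setLIntegral_mono' h.isOpen.measurableSet fun x hx => ?_
        refine (pow_le_pow_left' (hpt x hx) 2).trans ((ENNReal.add_sq_le_two _ _).trans ?_)
        rw [mul_pow, mul_pow _ ‖fderiv ℝ v (η x)‖ₑ, mul_assoc, mul_assoc]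
    _ = ENNReal.ofReal J * ∫⁻ y in D₀,
          (2 * C ^ 2 * ‖v y‖ₑ ^ 2 + 2 * (C * C) ^ 2 * ‖fderiv ℝ v y‖ₑ ^ 2) := by
        rw [h.setLIntegral_eq]
        congr 1
        refine setLIntegral_congr_fun h.isOpen₀.measurableSet fun y hy => ?_
        rw [h.eta_xi y hy]
    _ ≤ ENNReal.ofReal J * ∫⁻ y,
          (2 * C ^ 2 * ‖v y‖ₑ ^ 2 + 2 * (C * C) ^ 2 * ‖fderiv ℝ v y‖ₑ ^ 2) := by
        gcongr
        exact Measure.restrict_le_self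
    _ = _ := by
        rw [lintegral_add_left (by fun_prop),
          lintegral_const_mul' _ _ (by simp [ENNReal.mul_eq_top, hC]),
          lintegral_const_mul' _ _ (by simp [ENNReal.mul_eq_top, hC])]

end IsCoordChange

namespace IsCoordChange

variable {D D₀ : Set Plane} {ξ η : Plane → Plane} {J : ℝ}

/-- The transport of test fields, as a linear map into `L²`. -/
noncomputable def transportL2 (h : IsCoordChange D D₀ ξ η J) :
    solenoidalSubmodule D₀ →ₗ[ℝ] L2Field where
  toFun v := (memLp_of_mem_solenoidalTest (h.transportField_mem v.2)).1.toLp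
    (transportField D ξ η v)
  map_add' u v := by
    rw [← MemLp.toLp_add]
    congr 1
    funext x
    by_cases hx : x ∈ D <;> simp [transportField, hx]
  map_smul' c v := by
    rw [RingHom.id_apply, ← MemLp.toLp_const_smul]
    congr 1
    funext x
    by_cases hx : x ∈ D <;> simp [transportField, hx]

theorem coeFn_transportL2 (h : IsCoordChange D D₀ ξ η J) (v : solenoidalSubmodule D₀) :
    h.transportL2 v =ᵐ[volume] transportField D ξ η v :=
  (memLp_of_mem_solenoidalTest (h.transportField_mem v.2)).1.coeFn_toLp

theorem setIntegral_inner_transportField (h : IsCoordChange D D₀ ξ η J) (g : L2Field)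
    (v : solenoidalSubmodule D₀) :
    ∫ x in D, inner ℝ (g x) (transportField D ξ η v x) = inner ℝ g (h.transportL2 v) := by
  rw [L2.inner_def, setIntegral_eq_integral_of_forall_compl_eq_zero]
  · refine integral_congr_ae ?_
    filter_upwards [h.coeFn_transportL2 v] with x hx
    rw [hx]
  · intro x hx
    rw [transportField, indicator_of_notMem hx, inner_zero_right]

theorem inner_transportL2 (h : IsCoordChange D D₀ ξ η J) (u v : solenoidalSubmodule D₀) :
    inner ℝ (h.transportL2 u) (h.transportL2 v) =
      J * ∫ y in D₀, inner ℝ (fderiv ℝ ξ y (u.1 y)) (fderiv ℝ ξ y (v.1 y)) := by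
  rw [← h.setIntegral_inner_transportField, ← setIntegral_congr_fun (g := fun y => inner ℝ
    (fderiv ℝ ξ y (u.1 y)) (fderiv ℝ ξ y (v.1 y))) (f := fun y => inner ℝ
    (transportField D ξ η u (ξ y)) (transportField D ξ η v (ξ y))) h.isOpen₀.measurableSet
    (fun y hy => by simp only [h.transportField_xi _ hy]), ← h.setIntegral_eq
      fun x => inner ℝ (transportField D ξ η u x) (transportField D ξ η v x)]
  refine integral_congr_ae (ae_restrict_of_ae ?_)
  filter_upwards [h.coeFn_transportL2 u] with x hx
  rw [hx]

/-- The Schmidt orthonormalization in `L²` of the transports of the fields `e n`. At time `t` of a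
moving domain this is the moving basis. -/
noncomputable def orthonormalL2 (h : IsCoordChange D D₀ ξ η J) {e : ℕ → Plane → Plane}
    (he : ∀ n, e n ∈ solenoidalSubmodule D₀) : ℕ → L2Field :=
  schmidt (fun u v : L2Field => inner ℝ u v) fun n => h.transportL2 ⟨e n, he n⟩

theorem isOrthonormalOrZero_orthonormalL2 (h : IsCoordChange D D₀ ξ η J) {e : ℕ → Plane → Plane}
    (he : ∀ n, e n ∈ solenoidalSubmodule D₀) : IsOrthonormalOrZero (h.orthonormalL2 he) :=
  isOrthonormalOrZero_schmidt _

end IsCoordChange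

/-! ### The coordinate changes of a level preserving diffeomorphism -/

theorem hasFDerivAt_slice {F : Plane × ℝ → Plane × ℝ} (hF : ContDiff ℝ ∞ F) (x : Plane) (t : ℝ) :
    HasFDerivAt (fun x => (F (x, t)).1) ((ContinuousLinearMap.fst ℝ Plane ℝ).comp
      ((fderiv ℝ F (x, t)).comp (ContinuousLinearMap.inl ℝ Plane ℝ))) x :=
  (ContinuousLinearMap.fst ℝ Plane ℝ).hasFDerivAt.comp x
    (((hF.differentiable (by simp)) (x, t)).hasFDerivAt.comp x (hasFDerivAt_prodMk_left x t))

theorem spatialJac_apply {F : Plane × ℝ → Plane × ℝ} (hF : ContDiff ℝ ∞ F) (x : Plane) (t : ℝ)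
    (k j : Fin 2) :
    spatialJac F (x, t) k j =
      fderiv ℝ (fun x => (F (x, t)).1) x (EuclideanSpace.single k 1) j := by
  rw [(hasFDerivAt_slice hF x t).fderiv]
  simp [spatialJac]

/-- A row vector times the spatial Jacobian matrix is the derivative applied to the vector. -/
theorem vecMul_spatialJac {F : Plane × ℝ → Plane × ℝ} (hF : ContDiff ℝ ∞ F) (x z : Plane) (t : ℝ) :
    WithLp.toLp 2 (Matrix.vecMul (WithLp.ofLp z) (spatialJac F (x, t))) =
      fderiv ℝ (fun x => (F (x, t)).1) x z := by
  ext j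
  rw [ContinuousLinearMap.apply_eq_sum_single]
  simp [Matrix.vecMul, dotProduct, spatialJac_apply hF]

theorem det_spatialJac {F : Plane × ℝ → Plane × ℝ} (hF : ContDiff ℝ ∞ F) (x : Plane) (t : ℝ) :
    (fderiv ℝ (fun x => (F (x, t)).1) x).det = (spatialJac F (x, t)).det := by
  rw [ContinuousLinearMap.det,
    ← LinearMap.det_toMatrix (EuclideanSpace.basisFun (Fin 2) ℝ).toBasis, ← Matrix.det_transpose]
  congr 1
  ext k j
  rw [Matrix.transpose_apply, LinearMap.toMatrix_apply, spatialJac_apply hF]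
  simp

namespace LevelDiffeo

variable {T : ℝ} {D : ℝ → Set Plane} {D₀ : Set Plane}

/-- The spatial part `x ↦ y(x,t)` of the diffeomorphism at time `t`. -/
def eta (Φ : LevelDiffeo T D D₀) (t : ℝ) (x : Plane) : Plane := (Φ.L (x, t)).1

/-- The spatial part `y ↦ x(y,t)` of the inverse diffeomorphism at time `t`. -/
def xi (Φ : LevelDiffeo T D D₀) (t : ℝ) (y : Plane) : Plane := (Φ.Linv (y, t)).1

theorem eta_def (Φ : LevelDiffeo T D D₀) (t : ℝ) : Φ.eta t = fun x => (Φ.L (x, t)).1 := rfl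

theorem xi_def (Φ : LevelDiffeo T D D₀) (t : ℝ) : Φ.xi t = fun y => (Φ.Linv (y, t)).1 := rfl

theorem L_apply (Φ : LevelDiffeo T D D₀) {t : ℝ} (ht : t ∈ Icc 0 T) {x : Plane} (hx : x ∈ D t) :
    Φ.eta t x ∈ D₀ ∧ Φ.L (x, t) = (Φ.eta t x, t) := by
  have hp : (x, t) ∈ spaceTime T D := ⟨ht, hx⟩
  have h1 : Φ.L (x, t) ∈ spaceTime T fun _ => D₀ := Φ.image_domain ▸ mem_image_of_mem Φ.L hp
  exact ⟨h1.2, Prod.ext rfl (Φ.level _ (subset_closure hp))⟩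

theorem xi_eta (Φ : LevelDiffeo T D D₀) {t : ℝ} (ht : t ∈ Icc 0 T) {x : Plane} (hx : x ∈ D t) :
    Φ.xi t (Φ.eta t x) = x := by
  have hp : (x, t) ∈ spaceTime T D := ⟨ht, hx⟩
  rw [xi, ← (Φ.L_apply ht hx).2, Φ.invOn.1 (subset_closure hp)]

theorem exists_eta_eq (Φ : LevelDiffeo T D D₀) {t : ℝ} (ht : t ∈ Icc 0 T) {y : Plane}
    (hy : y ∈ D₀) : ∃ x ∈ D t, Φ.eta t x = y := by
  have hq : (y, t) ∈ spaceTime T fun _ => D₀ := ⟨ht, hy⟩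
  rw [← Φ.image_domain] at hq
  obtain ⟨⟨x, s⟩, hp, hpq⟩ := hq
  have hs : s = t := (Φ.level _ (subset_closure hp)).symm.trans (congrArg Prod.snd hpq)
  subst hs
  exact ⟨x, hp.2, by rw [eta, hpq]⟩

theorem isCoordChange (Φ : LevelDiffeo T D D₀) {t : ℝ} (ht : t ∈ Icc 0 T) (hD : IsOpen (D t))
    (hD₀ : IsOpen D₀) : IsCoordChange (D t) D₀ (Φ.xi t) (Φ.eta t) (Φ.J t) where
  isOpen := hD
  isOpen₀ := hD₀
  contDiff_xi := (Φ.contDiff_Linv.comp (contDiff_id.prodMk contDiff_const)).fst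
  contDiff_eta := (Φ.contDiff_L.comp (contDiff_id.prodMk contDiff_const)).fst
  mapsTo_xi := fun y hy => by
    obtain ⟨x, hx, rfl⟩ := Φ.exists_eta_eq ht hy
    rwa [Φ.xi_eta ht hx]
  mapsTo_eta := fun x hx => (Φ.L_apply ht hx).1
  eta_xi := fun y hy => by
    obtain ⟨x, hx, rfl⟩ := Φ.exists_eta_eq ht hy
    rw [Φ.xi_eta ht hx]
  xi_eta := fun x hx => Φ.xi_eta ht hx
  J_pos := Φ.J_pos t ht
  det_eta := fun x hx => by
    have hp : (x, t) ∈ spaceTime T D := ⟨ht, hx⟩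
    rw [← Φ.det_eq (x, t) (subset_closure hp), ← det_spatialJac Φ.contDiff_L]
    rfl

theorem metric_eq_inner (Φ : LevelDiffeo T D D₀) (i j : Fin 2) (y : Plane) (t : ℝ) :
    Φ.metric i j y t = inner ℝ (fderiv ℝ (Φ.xi t) y (EuclideanSpace.single i 1))
      (fderiv ℝ (Φ.xi t) y (EuclideanSpace.single j 1)) := by
  rw [metric, PiLp.inner_apply]
  refine Finset.sum_congr rfl fun k _ => ?_
  rw [spatialJac_apply Φ.contDiff_Linv, spatialJac_apply Φ.contDiff_Linv]
  simp [xi_def, mul_comm]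

theorem pairing_eq_inner (Φ : LevelDiffeo T D D₀) {t : ℝ}
    (h : IsCoordChange (D t) D₀ (Φ.xi t) (Φ.eta t) (Φ.J t)) (u v : solenoidalSubmodule D₀) :
    Φ.pairing t u v = inner ℝ (h.transportL2 u) (h.transportL2 v) := by
  have hξ : Continuous (fderiv ℝ (Φ.xi t)) := h.contDiff_xi.continuous_fderiv (by simp)
  have hu : Continuous u.1 := u.2.1.continuous
  have hv : Continuous v.1 := v.2.1.continuous
  have hint : ∀ i j : Fin 2, Integrable fun y => Φ.metric i j y t * u.1 y i * v.1 y j * Φ.J t := by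
    intro i j
    refine Continuous.integrable_of_hasCompactSupport ?_ ?_
    · simp_rw [metric_eq_inner]
      fun_prop
    · have hc : HasCompactSupport fun y => v.1 y j :=
        HasCompactSupport.comp_left (g := fun z : Plane => z j) v.2.2.1 rfl
      exact hc.mul_left.mul_right
  rw [h.inner_transportL2, pairing]
  simp_rw [← integral_finsetSum Finset.univ fun j _ => (hint _ j).integrableOn]
  rw [← integral_finsetSum Finset.univ fun i _ => (integrable_finsetSum Finset.univ
    fun j _ => hint i j).integrableOn, ← integral_const_mul]
  refine integral_congr_ae (ae_of_all _ fun y => ?_)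
  simp only
  rw [ContinuousLinearMap.apply_eq_sum_single _ (u.1 y),
    ContinuousLinearMap.apply_eq_sum_single _ (v.1 y)]
  simp_rw [sum_inner, inner_sum, real_inner_smul_left, real_inner_smul_right, metric_eq_inner,
    Finset.mul_sum]
  refine Finset.sum_congr rfl fun i _ => Finset.sum_congr rfl fun j _ => ?_
  ring

/-- The coefficients with respect to the moving basis are `L²` inner products: the pairing `⟨·,·⟩_t`
is the inner product of the transported fields, so transport commutes with the Schmidt process. -/
theorem setIntegral_inner_movingBasis (Φ : LevelDiffeo T D D₀) {t : ℝ}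
    (h : IsCoordChange (D t) D₀ (Φ.xi t) (Φ.eta t) (Φ.J t)) {e : ℕ → Plane → Plane}
    (he : ∀ n, e n ∈ solenoidalSubmodule D₀) (g : L2Field) (i : ℕ) :
    ∫ x in D t, inner ℝ (g x) (Φ.movingBasis e i t x) = inner ℝ g (h.orthonormalL2 he i) := by
  obtain ⟨hS, hτ⟩ := map_schmidt h.transportL2 (Φ.pairing_eq_inner h) he i
  rw [IsCoordChange.orthonormalL2, ← hτ, ← h.setIntegral_inner_transportField]
  refine setIntegral_congr_fun h.isOpen.measurableSet fun x hx => ?_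
  have hinv : (spatialJac Φ.L (x, t))⁻¹ = spatialJac Φ.Linv (Φ.eta t x, t) := by
    refine Matrix.inv_eq_left_inv ?_
    have h1 : ∀ k, fderiv ℝ (Φ.eta t) x (fderiv ℝ (Φ.xi t) (Φ.eta t x)
        (EuclideanSpace.single k 1)) = EuclideanSpace.single k 1 := fun k => by
      have h2 := h.fderiv_eta_xi (h.mapsTo_eta hx)
      rw [h.xi_eta x hx] at h2
      exact congrArg (fun A : Plane →L[ℝ] Plane => A (EuclideanSpace.single k 1)) h2
    ext k j
    have h3 := congrArg (fun z : Plane => z j) (h1 k)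
    simp only at h3
    rw [ContinuousLinearMap.apply_eq_sum_single (fderiv ℝ (Φ.eta t) x)] at h3
    rw [Matrix.mul_apply]
    simp_rw [spatialJac_apply Φ.contDiff_L, spatialJac_apply Φ.contDiff_Linv]
    simpa [Matrix.one_apply, eta_def, xi_def, Pi.single_apply, eq_comm] using h3
  simp only
  rw [transportField, indicator_of_mem hx, movingBasis, hinv, refBasis]
  congr 1
  exact vecMul_spatialJac Φ.contDiff_Linv _ _ _

end LevelDiffeo

/-! ### Friedrichs' inequality on the moving domain -/

/-- The derivative of `x ↦ (F (x, t)).1` at `x`, as a function of `(x, t)`. -/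
noncomputable def sliceDeriv (F : Plane × ℝ → Plane × ℝ) (p : Plane × ℝ) : Plane →L[ℝ] Plane :=
  (ContinuousLinearMap.fst ℝ Plane ℝ).comp
    ((fderiv ℝ F p).comp (ContinuousLinearMap.inl ℝ Plane ℝ))

theorem contDiff_sliceDeriv {F : Plane × ℝ → Plane × ℝ} (hF : ContDiff ℝ ∞ F) :
    ContDiff ℝ ∞ (sliceDeriv F) :=
  contDiff_const.clm_comp ((hF.fderiv_right (m := ∞) (by simp)).clm_comp contDiff_const)

theorem exists_enorm_le_of_continuous {E : Type*} [NormedAddCommGroup E] {D₀ : Set Plane}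
    (hD₀ : Bornology.IsBounded D₀) (T : ℝ) {F : Plane × ℝ → E} (hF : Continuous F) :
    ∃ c : ℝ, 1 ≤ c ∧ ∀ t ∈ Icc 0 T, ∀ y ∈ D₀, ‖F (y, t)‖ₑ ≤ ENNReal.ofReal c := by
  obtain ⟨c, hc⟩ := (hD₀.isCompact_closure.prod (isCompact_Icc (a := (0 : ℝ))
    (b := T))).exists_bound_of_continuousOn hF.continuousOn
  refine ⟨max 1 c, le_max_left _ _, fun t ht y hy => ?_⟩
  rw [← ofReal_norm]
  exact ENNReal.ofReal_le_ofReal ((hc _ ⟨subset_closure hy, ht⟩).trans (le_max_right _ _))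

theorem IsCoordChange.exists_transportL2_mem_span {D D₀ : Set Plane} {ξ η : Plane → Plane} {J : ℝ}
    (h : IsCoordChange D D₀ ξ η J) {e : ℕ → Plane → Plane} (he : ∀ n, e n ∈ solenoidalSubmodule D₀)
    {n : ℕ} {s : Plane → Plane} (hs : s ∈ Submodule.span ℝ (e '' Iio n)) :
    ∃ hs : s ∈ solenoidalSubmodule D₀, h.transportL2 ⟨s, hs⟩ ∈
      Submodule.span ℝ ((fun n => h.transportL2 ⟨e n, he n⟩) '' Iio n) := by
  induction hs using Submodule.span_induction with
  | mem x hx =>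
    obtain ⟨k, hk, rfl⟩ := hx
    exact ⟨he k, Submodule.subset_span (mem_image_of_mem _ hk)⟩
  | zero =>
    have h0 : h.transportL2 ⟨0, zero_mem _⟩ = 0 := map_zero _
    exact ⟨zero_mem _, h0 ▸ zero_mem _⟩
  | add x y _ _ hx hy =>
    obtain ⟨hx1, hx2⟩ := hx
    obtain ⟨hy1, hy2⟩ := hy
    refine ⟨add_mem hx1 hy1, ?_⟩
    convert add_mem hx2 hy2
    rw [← map_add]
    rfl
  | smul c x _ hx =>
    obtain ⟨hx1, hx2⟩ := hx
    refine ⟨Submodule.smul_mem _ c hx1, ?_⟩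
    convert Submodule.smul_mem _ c hx2
    rw [← map_smul]
    rfl

namespace LevelDiffeo

variable {T : ℝ} {D : ℝ → Set Plane} {D₀ : Set Plane}

/-- The coordinate changes at all times have uniformly bounded derivatives, as the
closed cylinder over `D₀` is compact. -/
theorem exists_uniform_bound (Φ : LevelDiffeo T D D₀) (hD : ∀ t ∈ Icc 0 T, IsOpen (D t))
    (hD₀ : IsOpen D₀) (hb : Bornology.IsBounded D₀) :
    ∃ c : ℝ, 1 ≤ c ∧ ∀ t ∈ Icc 0 T, ∀ y ∈ D₀,
      ‖fderiv ℝ (Φ.xi t) y‖ₑ ≤ ENNReal.ofReal c ∧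
      ‖fderiv ℝ (Φ.eta t) (Φ.xi t y)‖ₑ ≤ ENNReal.ofReal c ∧
      ‖fderiv ℝ (fun y => fderiv ℝ (Φ.eta t) (Φ.xi t y)) y‖ₑ ≤ ENNReal.ofReal c ∧
      ENNReal.ofReal (Φ.J t) ≤ ENNReal.ofReal c ∧ ENNReal.ofReal (Φ.J t)⁻¹ ≤ ENNReal.ofReal c := by
  let F₁ := sliceDeriv Φ.Linv
  let F₂ : Plane × ℝ → Plane →L[ℝ] Plane := fun p => sliceDeriv Φ.L ((Φ.Linv p).1, p.2)
  have hF₁ : ContDiff ℝ ∞ F₁ := contDiff_sliceDeriv Φ.contDiff_Linv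
  have hF₂ : ContDiff ℝ ∞ F₂ := (contDiff_sliceDeriv Φ.contDiff_L).comp
    (Φ.contDiff_Linv.fst.prodMk contDiff_snd)
  have h₁ : ∀ t y, fderiv ℝ (Φ.xi t) y = F₁ (y, t) := fun t y =>
    (hasFDerivAt_slice Φ.contDiff_Linv y t).fderiv
  have h₂ : ∀ t y, fderiv ℝ (Φ.eta t) (Φ.xi t y) = F₂ (y, t) := fun t y =>
    (hasFDerivAt_slice Φ.contDiff_L (Φ.xi t y) t).fderiv
  have h₃ : ∀ t y, fderiv ℝ (fun y => F₂ (y, t)) y =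
      (fderiv ℝ F₂ (y, t)).comp (ContinuousLinearMap.inl ℝ Plane ℝ) := fun t y =>
    (HasFDerivAt.comp (g := F₂) (f := fun y => (y, t)) y
      ((hF₂.differentiable (by simp)) (y, t)).hasFDerivAt (hasFDerivAt_prodMk_left y t)).fderiv
  obtain ⟨c₁, hc₁, hb₁⟩ := exists_enorm_le_of_continuous hb T hF₁.continuous
  obtain ⟨c₂, hc₂, hb₂⟩ := exists_enorm_le_of_continuous hb T hF₂.continuous
  have hF₃ : Continuous fun p => (fderiv ℝ F₂ p).comp (ContinuousLinearMap.inl ℝ Plane ℝ) :=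
    (hF₂.continuous_fderiv (by simp)).clm_comp continuous_const
  obtain ⟨c₃, hc₃, hb₃⟩ := exists_enorm_le_of_continuous
    (E := Plane →L[ℝ] Plane →L[ℝ] Plane) hb T hF₃
  obtain ⟨c₄, hc₄, hb₄⟩ := exists_enorm_le_of_continuous hb T
    (ContinuousLinearMap.continuous_det.comp hF₁.continuous)
  obtain ⟨c₅, hc₅, hb₅⟩ := exists_enorm_le_of_continuous hb T
    (ContinuousLinearMap.continuous_det.comp hF₂.continuous)
  refine ⟨c₁ + c₂ + c₃ + c₄ + c₅, by linarith, fun t ht y hy => ?_⟩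
  have hΦ := Φ.isCoordChange ht (hD t ht) hD₀
  have hdet₁ : ENNReal.ofReal (Φ.J t) = ‖(F₁ (y, t)).det‖ₑ := by
    rw [← h₁, hΦ.det_xi hy, Real.enorm_of_nonneg hΦ.J_pos.le]
  have hdet₂ : ENNReal.ofReal (Φ.J t)⁻¹ = ‖(F₂ (y, t)).det‖ₑ := by
    rw [← h₂, hΦ.det_eta _ (hΦ.mapsTo_xi hy), Real.enorm_of_nonneg (inv_pos.2 hΦ.J_pos).le]
  rw [hdet₁, hdet₂, h₁]
  simp_rw [h₂]
  rw [h₃]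
  exact ⟨(hb₁ t ht y hy).trans (ENNReal.ofReal_le_ofReal (by linarith)),
    (hb₂ t ht y hy).trans (ENNReal.ofReal_le_ofReal (by linarith)),
    (hb₃ t ht y hy).trans (ENNReal.ofReal_le_ofReal (by linarith)),
    (hb₄ t ht y hy).trans (ENNReal.ofReal_le_ofReal (by linarith)),
    (hb₅ t ht y hy).trans (ENNReal.ofReal_le_ofReal (by linarith))⟩

end LevelDiffeo

theorem IsGalerkinSequence.nonempty {D₀ : Set Plane} {e : ℕ → Plane → Plane}
    (he : IsGalerkinSequence D₀ e) : D₀.Nonempty := by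
  by_contra h
  rw [not_nonempty_iff_eq_empty] at h
  have h1 := (he.mem 0).2.2.1
  rw [h, subset_empty_iff, tsupport_eq_empty_iff] at h1
  exact he.linearIndependent.ne_zero 0 h1

/-- Friedrichs' inequality for one coordinate change, in terms of bounds `c` for its derivatives
and of the approximation property on the fixed domain. -/
theorem IsCoordChange.friedrichs_of_mem_solenoidalTest {D D₀ : Set Plane} {ξ η : Plane → Plane}
    {J : ℝ}
    (h : IsCoordChange D D₀ ξ η J) {e : ℕ → Plane → Plane} (he : ∀ n, e n ∈ solenoidalSubmodule D₀)
    (hne : D₀.Nonempty) {c : ℝ} (hc : 1 ≤ c) (hbound : ∀ y ∈ D₀,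
      ‖fderiv ℝ ξ y‖ₑ ≤ ENNReal.ofReal c ∧
      ‖fderiv ℝ η (ξ y)‖ₑ ≤ ENNReal.ofReal c ∧
      ‖fderiv ℝ (fun y => fderiv ℝ η (ξ y)) y‖ₑ ≤ ENNReal.ofReal c ∧
      ENNReal.ofReal J ≤ ENNReal.ofReal c ∧ ENNReal.ofReal J⁻¹ ≤ ENNReal.ofReal c)
    {δ : ℝ} (hδ : 0 ≤ δ) {n : ℕ}
    (happrox : ∀ v ∈ solenoidalTest D₀, ∃ s ∈ Submodule.span ℝ (e '' Iio n),
      ∫⁻ x, ‖v x - s x‖ₑ ^ 2 ≤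
        ENNReal.ofReal δ * ((∫⁻ x, ‖v x‖ₑ ^ 2) + ∫⁻ x, ‖fderiv ℝ v x‖ₑ ^ 2))
    {u : Plane → Plane} (hu : u ∈ solenoidalTest D) {f : L2Field} (hfu : f =ᵐ[volume] u)
    {G : L2Grad} (hGu : G =ᵐ[volume] gradField u) :
    ‖f‖ ^ 2 - ∑ i ∈ Finset.range n, inner ℝ f (h.orthonormalL2 he i) ^ 2 ≤
      5 * c ^ 8 * δ * (‖f‖ ^ 2 + ‖G‖ ^ 2) := by
  set W := h.orthonormalL2 he with hWdef
  have hW : IsOrthonormalOrZero W := IsCoordChange.isOrthonormalOrZero_orthonormalL2 _ _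
  obtain ⟨y₀, hy₀⟩ := hne
  obtain ⟨-, -, -, hJ, hJ'⟩ := hbound y₀ hy₀
  set C := ENNReal.ofReal c with hC
  have hC1 : 1 ≤ C := by rw [hC, ← ENNReal.ofReal_one]; exact ENNReal.ofReal_le_ofReal hc
  have hCtop : C ≠ ⊤ := ENNReal.ofReal_ne_top
  set v := transportField D₀ η ξ u with hv
  have hvmem : v ∈ solenoidalTest D₀ := h.symm.transportField_mem hu
  obtain ⟨s, hs, hvs⟩ := happrox v hvmem
  obtain ⟨hsS, hsW⟩ := h.exists_transportL2_mem_span he hs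
  have hsW' : h.transportL2 ⟨s, hsS⟩ ∈ Submodule.span ℝ (W '' Iio n) :=
    span_image_Iio_le_span_schmidt _ n hsW
  have hfv : f = h.transportL2 ⟨v, hvmem⟩ := by
    refine Lp.ext ?_
    filter_upwards [hfu, h.coeFn_transportL2 ⟨v, hvmem⟩] with x hx1 hx2
    rw [hx1, hx2]
    exact (congrFun (h.transportField_transportField
      ((subset_tsupport u).trans hu.2.2.1)) x).symm
  have hfsub : f - h.transportL2 ⟨s, hsS⟩ = h.transportL2 ⟨v - s, sub_mem hvmem hsS⟩ := by
    rw [hfv, ← map_sub]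
    rfl
  -- energies of `u` and `v` in terms of those of `f` and `G`
  have hunorm : ∫⁻ x, ‖u x‖ₑ ^ 2 = ‖f‖ₑ ^ 2 := (Lp.enorm_sq_eq_lintegral f hfu).symm
  have hgnorm : ∫⁻ x, ‖fderiv ℝ u x‖ₑ ^ 2 ≤ ‖G‖ₑ ^ 2 := by
    rw [Lp.enorm_sq_eq_lintegral G hGu]
    exact lintegral_mono fun x => pow_le_pow_left' (enorm_fderiv_le_gradField u x) 2
  have hv0 : ∫⁻ y, ‖v y‖ₑ ^ 2 ≤ C * (C ^ 2 * ‖f‖ₑ ^ 2) := by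
    refine (h.symm.lintegral_transportField_sq_le u hCtop fun x hx => ?_).trans ?_
    · have := (hbound _ (h.mapsTo_eta hx)).2.1
      rwa [h.xi_eta x hx] at this
    · rw [hunorm]; gcongr
  have hv1 : ∫⁻ y, ‖fderiv ℝ v y‖ₑ ^ 2 ≤
      C * (2 * C ^ 2 * ‖f‖ₑ ^ 2 + 2 * (C * C) ^ 2 * ‖G‖ₑ ^ 2) := by
    refine (h.symm.lintegral_fderiv_transportField_sq_le hu hCtop
      (fun y hy => (hbound y hy).2.1) (fun y hy => (hbound y hy).1)
      (fun y hy => (hbound y hy).2.2.1)).trans ?_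
    rw [hunorm]
    gcongr
  have hCpow : C ^ 3 ≤ C ^ 5 := pow_le_pow_right₀ hC1 (by norm_num)
  -- `f` is the transport of `v`, and the transport of `s` lies in the span of the `W i`, `i < n`.
  have hmain : ‖f - h.transportL2 ⟨s, hsS⟩‖ₑ ^ 2 ≤
      5 * C ^ 8 * ENNReal.ofReal δ * (‖f‖ₑ ^ 2 + ‖G‖ₑ ^ 2) := by
    rw [hfsub, Lp.enorm_sq_eq_lintegral _ (h.coeFn_transportL2 _)]
    calc _ ≤ ENNReal.ofReal J * (C ^ 2 * ∫⁻ y, ‖(v - s) y‖ₑ ^ 2) :=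
          h.lintegral_transportField_sq_le (v - s) hCtop fun y hy => (hbound y hy).1
      _ ≤ C * (C ^ 2 * (ENNReal.ofReal δ * (C * (C ^ 2 * ‖f‖ₑ ^ 2) +
          C * (2 * C ^ 2 * ‖f‖ₑ ^ 2 + 2 * (C * C) ^ 2 * ‖G‖ₑ ^ 2)))) := by
          gcongr
          refine hvs.trans ?_
          gcongr
      _ = C ^ 3 * ENNReal.ofReal δ * (3 * C ^ 3 * ‖f‖ₑ ^ 2 + 2 * C ^ 5 * ‖G‖ₑ ^ 2) := by ring
      _ ≤ C ^ 3 * ENNReal.ofReal δ * (5 * C ^ 5 * ‖f‖ₑ ^ 2 + 5 * C ^ 5 * ‖G‖ₑ ^ 2) := by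
          gcongr <;> norm_num
      _ = _ := by ring
  refine (hW.norm_sq_sub_le f hsW').trans ?_
  have h5 : (5 : ℝ≥0∞) = ENNReal.ofReal 5 := by norm_num
  rw [h5, hC, ← ofReal_norm, ← ofReal_norm, ← ofReal_norm, ← ENNReal.ofReal_pow (by positivity),
    ← ENNReal.ofReal_pow (by positivity), ← ENNReal.ofReal_pow (by positivity),
    ← ENNReal.ofReal_pow (by positivity), ← ENNReal.ofReal_mul (by positivity),
    ← ENNReal.ofReal_mul (by positivity), ← ENNReal.ofReal_add (by positivity) (by positivity),
    ← ENNReal.ofReal_mul (by positivity), ENNReal.ofReal_le_ofReal_iff (by positivity)] at hmain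
  exact hmain

/-- Friedrichs' inequality for all of `V(D)`, by density of the test fields. -/
theorem IsCoordChange.friedrichs {D D₀ : Set Plane} {ξ η : Plane → Plane} {J : ℝ}
    (h : IsCoordChange D D₀ ξ η J) {e : ℕ → Plane → Plane} (he : ∀ n, e n ∈ solenoidalSubmodule D₀)
    (hne : D₀.Nonempty) {c : ℝ} (hc : 1 ≤ c) (hbound : ∀ y ∈ D₀,
      ‖fderiv ℝ ξ y‖ₑ ≤ ENNReal.ofReal c ∧
      ‖fderiv ℝ η (ξ y)‖ₑ ≤ ENNReal.ofReal c ∧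
      ‖fderiv ℝ (fun y => fderiv ℝ η (ξ y)) y‖ₑ ≤ ENNReal.ofReal c ∧
      ENNReal.ofReal J ≤ ENNReal.ofReal c ∧ ENNReal.ofReal J⁻¹ ≤ ENNReal.ofReal c)
    {δ : ℝ} (hδ : 0 ≤ δ) {n : ℕ}
    (happrox : ∀ v ∈ solenoidalTest D₀, ∃ s ∈ Submodule.span ℝ (e '' Iio n),
      ∫⁻ x, ‖v x - s x‖ₑ ^ 2 ≤
        ENNReal.ofReal δ * ((∫⁻ x, ‖v x‖ₑ ^ 2) + ∫⁻ x, ‖fderiv ℝ v x‖ₑ ^ 2))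
    {u : L2Field} {G : L2Grad} (hu : HasGradV D u G) :
    ‖u‖ ^ 2 - ∑ i ∈ Finset.range n, inner ℝ u (h.orthonormalL2 he i) ^ 2 ≤
      5 * c ^ 8 * δ * (‖u‖ ^ 2 + ‖G‖ ^ 2) := by
  generalize hW : h.orthonormalL2 he = W
  have hScl : IsClosed {p : L2Field × L2Grad |
      ‖p.1‖ ^ 2 - ∑ i ∈ Finset.range n, inner ℝ p.1 (W i) ^ 2 ≤
        5 * c ^ 8 * δ * (‖p.1‖ ^ 2 + ‖p.2‖ ^ 2)} := isClosed_le (by fun_prop) (by fun_prop)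
  have hsub := closure_minimal (s := gradGraph (solenoidalTest D)) (fun p hp => ?_) hScl
  · have hu' : (u, G) ∈ closure (gradGraph (solenoidalTest D)) := hu
    have h1 := hsub hu'
    rw [mem_ofPred_eq] at h1
    exact h1
  obtain ⟨u, hu, hfu, hGu⟩ := hp
  rw [mem_ofPred_eq, ← hW]
  exact h.friedrichs_of_mem_solenoidalTest he hne hc hbound hδ happrox hu hfu hGu

/-- Friedrichs' inequality, uniformly in time: up to `ε` times its `H¹` norm, a field
in `V(D t)` is controlled by its first `n` coefficients with respect to the moving basis. -/
theorem LevelDiffeo.exists_friedrichs {T : ℝ} {D : ℝ → Set Plane} {D₀ : Set Plane}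
    (Φ : LevelDiffeo T D D₀) (hD : ∀ t ∈ Icc 0 T, IsOpen (D t))
    (hD₀ : IsOpen D₀) (hb : Bornology.IsBounded D₀) {e : ℕ → Plane → Plane}
    (he : IsGalerkinSequence D₀ e) {ε : ℝ} (hε : 0 < ε) :
    ∃ n : ℕ, ∀ t (ht : t ∈ Icc 0 T) (u : L2Field) (G : L2Grad), HasGradV (D t) u G →
      ‖u‖ ^ 2 - ∑ i ∈ Finset.range n,
        inner ℝ u ((Φ.isCoordChange ht (hD t ht) hD₀).orthonormalL2 he.mem i) ^ 2 ≤
        ε * (‖u‖ ^ 2 + ‖G‖ ^ 2) := by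
  obtain ⟨c, hc, hbound⟩ := Φ.exists_uniform_bound hD hD₀ hb
  have hc0 : 0 < c := by linarith
  obtain ⟨n, hn⟩ := he.exists_uniform_approx hb (ε := ε / (5 * c ^ 8)) (by positivity)
  refine ⟨n, fun t ht u G hu => ?_⟩
  have := (Φ.isCoordChange ht (hD t ht) hD₀).friedrichs he.mem he.nonempty hc (hbound t ht)
    (by positivity) hn hu
  rwa [mul_div_cancel₀ _ (by positivity)] at this

/-! ### The space `L²([0,T]; H_t)` and gradient norms -/

/-- A bound in terms of `‖G‖` for all gradients `G` of `f` passes to the infimum `gradNorm D f`. -/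
theorem le_add_mul_gradNorm_sq {D : Set Plane} {f : L2Field} (hf : f ∈ spaceV D) {x a b : ℝ≥0∞}
    (hb : b ≠ ⊤) (h : ∀ G, HasGradV D f G → x ≤ a + b * ‖G‖ₑ ^ 2) :
    x ≤ a + b * gradNorm D f ^ 2 := by
  have hcl : IsClosed {r : ℝ≥0∞ | x ≤ a + b * r ^ 2} := isClosed_le continuous_const
    (continuous_const.add ((ENNReal.continuous_const_mul hb).comp (ENNReal.continuous_pow 2)))
  obtain ⟨G₀, hG₀⟩ := hf
  have hm : gradNorm D f ∈ closure (range fun G : {G // HasGradV D f G} => ‖G.1‖ₑ) := by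
    rw [gradNorm, iInf_subtype']
    exact csInf_mem_closure ⟨_, mem_range_self ⟨G₀, hG₀⟩⟩ (OrderBot.bddBelow _)
  have hsub := closure_minimal (t := {r : ℝ≥0∞ | x ≤ a + b * r ^ 2})
    (range_subset_iff.2 fun G : {G // HasGradV D f G} => h G.1 G.2) hcl
  exact hsub hm

/-- `L²([0,T]; H_t)` is closed: a sequence converging in `L²` has a subsequence converging almost
everywhere, and each `H_t` is closed. -/
theorem isClosed_L2H (T : ℝ) (D : ℝ → Set Plane) : IsClosed (L2H T D) := by
  refine isSeqClosed_iff_isClosed.1 fun F f hF hFf => ?_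
  obtain ⟨ns, -, hns⟩ := (tendstoInMeasure_of_tendsto_Lp hFf).exists_seq_tendsto_ae
  have hall : ∀ᵐ t ∂timeMeasure T, ∀ k, F (ns k) t ∈ spaceH (D t) := ae_all_iff.2 fun k => hF _
  have hlim : ∀ᵐ t ∂timeMeasure T, f t ∈ spaceH (D t) := by
    filter_upwards [hall, hns] with t ht1 ht2
    exact isClosed_closure.mem_of_tendsto ht2 (Filter.Eventually.of_forall ht1)
  exact hlim


/-! ### Total boundedness -/

/-- An equicontinuous family on `[0,T]` is controlled by its values at finitely many times. -/
theorem EquicontFamily.exists_finite_times {T : ℝ} {A : ℕ → Set (Icc (0 : ℝ) T → ℝ)}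
    (hA : ∀ i, EquicontFamily T (A i)) (n : ℕ) {η : ℝ} (hη : 0 < η) :
    ∃ P : Set (Icc (0 : ℝ) T), P.Finite ∧ ∀ i < n, ∀ a ∈ A i, ∀ b ∈ A i,
      (∀ p ∈ P, |a p - b p| < η) → ∀ t, |a t - b t| < 3 * η := by
  obtain ⟨δ, hδ, hδA⟩ : ∃ δ > 0, ∀ i < n, ∀ s t : Icc (0 : ℝ) T, |(s : ℝ) - t| < δ →
      ∀ h ∈ A i, |h t - h s| < η := by
    induction n with
    | zero => exact ⟨1, one_pos, fun i hi => absurd hi (Nat.not_lt_zero i)⟩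
    | succ n ih =>
      obtain ⟨δ, hδ, h⟩ := ih
      obtain ⟨δ', hδ', h'⟩ := hA n η hη
      refine ⟨min δ δ', lt_min hδ hδ', fun i hi s t hst => ?_⟩
      rcases Nat.lt_succ_iff_lt_or_eq.1 hi with hi | rfl
      · exact h i hi s t (hst.trans_le (min_le_left _ _))
      · exact h' s t (hst.trans_le (min_le_right _ _))
  obtain ⟨P, -, hPf, hP⟩ := finite_cover_balls_of_compact (isCompact_univ (X := Icc (0 : ℝ) T)) hδ
  refine ⟨P, hPf, fun i hi a ha b hb hab t => ?_⟩
  obtain ⟨p, hp, htp⟩ := mem_iUnion₂.1 (hP (mem_univ t))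
  have h1 := abs_lt.1 (hδA i hi t p htp a ha)
  have h2 := abs_lt.1 (hδA i hi t p htp b hb)
  have h3 := abs_lt.1 (hab p hp)
  exact abs_lt.2 ⟨by linarith, by linarith⟩

namespace LevelDiffeo

variable {T : ℝ} {D : ℝ → Set Plane} {D₀ : Set Plane}

/-- The coefficient `(g(t), w_i(t))_t`. -/
noncomputable def coeff (Φ : LevelDiffeo T D D₀) (e : ℕ → Plane → Plane) (g : ℝ → L2Field)
    (i : ℕ) (t : ℝ) : ℝ :=
  ∫ x in D t, inner ℝ (g t x) (Φ.movingBasis e i t x)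

/-- The squared distance of `g(t)` from the span of the first `n` fields of the moving basis. -/
noncomputable def defect (Φ : LevelDiffeo T D D₀) (e : ℕ → Plane → Plane) (g : ℝ → L2Field)
    (n : ℕ) (t : ℝ) : ℝ :=
  ‖g t‖ ^ 2 - ∑ i ∈ Finset.range n, Φ.coeff e g i t ^ 2

end LevelDiffeo

section SetK

variable {T : ℝ} {D : ℝ → Set Plane} {D₀ : Set Plane} {Φ : LevelDiffeo T D D₀}
  {e : ℕ → Plane → Plane} {N : ℝ} {A : ℕ → Set (Icc (0 : ℝ) T → ℝ)} {g g' : ℝ → L2Field}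

theorem coeff_mem_of_mem_setK (hg : g ∈ setK Φ e N A) (i : ℕ) :
    (fun t : Icc (0 : ℝ) T => Φ.coeff e g i t) ∈ A i := hg.2.2.2.2.2 i

theorem norm_le_of_mem_setK (hg : g ∈ setK Φ e N A) {t : ℝ} (ht : t ∈ Icc 0 T) : ‖g t‖ ≤ N :=
  hg.2.2.2.1 t ht

theorem memLp_two_of_mem_setK (hg : g ∈ setK Φ e N A) : MemLp g 2 (timeMeasure T) :=
  hg.2.1.mono_exponent le_top

theorem exists_L2H_of_mem_setK (hg : g ∈ setK Φ e N A) : ∃ f : L2H T D,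
    (f : Lp L2Field 2 (timeMeasure T)) =ᵐ[timeMeasure T] g := by
  have h2 := memLp_two_of_mem_setK hg
  have hmem : ∀ᵐ t ∂timeMeasure T, h2.toLp g t ∈ spaceH (D t) := by
    filter_upwards [h2.coeFn_toLp, ae_restrict_mem measurableSet_Icc] with t ht1 ht2
    rw [ht1]
    exact hg.1 t ht2
  exact ⟨⟨h2.toLp g, hmem⟩, h2.coeFn_toLp⟩

theorem continuousOn_coeff (hA : ∀ i, EquicontFamily T (A i)) (hg : g ∈ setK Φ e N A) (i : ℕ) :
    ContinuousOn (Φ.coeff e g i) (Icc 0 T) := by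
  rw [continuousOn_iff_continuous_domRestrict, Metric.continuous_iff]
  intro t ε hε
  obtain ⟨δ, hδ, h⟩ := hA i ε hε
  refine ⟨δ, hδ, fun s hs => ?_⟩
  rw [dist_comm] at hs
  exact h t s hs _ (coeff_mem_of_mem_setK hg i)

theorem aemeasurable_defect (hA : ∀ i, EquicontFamily T (A i)) (hg : g ∈ setK Φ e N A) (n : ℕ) :
    AEMeasurable (Φ.defect e g n) (timeMeasure T) := by
  have h1 : AEMeasurable (fun t => ‖g t‖) (timeMeasure T) := hg.2.1.1.norm.aemeasurable
  have h2 : ∀ i, AEMeasurable (Φ.coeff e g i) (timeMeasure T) := fun i =>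
    (continuousOn_coeff hA hg i).aemeasurable measurableSet_Icc
  unfold LevelDiffeo.defect
  fun_prop

theorem coeff_eq_inner (hD : ∀ t ∈ Icc 0 T, IsOpen (D t)) (hD₀ : IsOpen D₀)
    (he : ∀ n, e n ∈ solenoidalSubmodule D₀)
    (g : ℝ → L2Field) (i : ℕ) {t : ℝ} (ht : t ∈ Icc 0 T) :
    Φ.coeff e g i t =
      inner ℝ (g t) ((Φ.isCoordChange ht (hD t ht) hD₀).orthonormalL2 he i) :=
  Φ.setIntegral_inner_movingBasis _ he _ _

theorem abs_coeff_le (hD : ∀ t ∈ Icc 0 T, IsOpen (D t)) (hD₀ : IsOpen D₀)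
    (he : ∀ n, e n ∈ solenoidalSubmodule D₀)
    (hg : g ∈ setK Φ e N A) (i : ℕ) {t : ℝ} (ht : t ∈ Icc 0 T) :
    |Φ.coeff e g i t| ≤ N := by
  rw [coeff_eq_inner hD hD₀ he g i ht]
  set W := (Φ.isCoordChange ht (hD t ht) hD₀).orthonormalL2 he with hWdef
  have hW : IsOrthonormalOrZero W := IsCoordChange.isOrthonormalOrZero_orthonormalL2 _ _
  have h1 := hW.norm_le_one i
  have h2 := norm_le_of_mem_setK hg ht
  calc _ ≤ ‖g t‖ * ‖W i‖ := abs_real_inner_le_norm _ _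
    _ ≤ ‖g t‖ * 1 := by gcongr
    _ ≤ N := by linarith

theorem defect_nonneg (hD : ∀ t ∈ Icc 0 T, IsOpen (D t)) (hD₀ : IsOpen D₀)
    (he : ∀ n, e n ∈ solenoidalSubmodule D₀)
    (g : ℝ → L2Field) (n : ℕ) {t : ℝ} (ht : t ∈ Icc 0 T) :
    0 ≤ Φ.defect e g n t := by
  unfold LevelDiffeo.defect
  simp_rw [coeff_eq_inner hD hD₀ he g _ ht]
  have hW : IsOrthonormalOrZero ((Φ.isCoordChange ht (hD t ht) hD₀).orthonormalL2 he) :=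
    IsCoordChange.isOrthonormalOrZero_orthonormalL2 _ _
  rw [← hW.norm_sub_sum_smul_sq]
  positivity

theorem norm_sub_sq_le_defect (hD : ∀ t ∈ Icc 0 T, IsOpen (D t)) (hD₀ : IsOpen D₀)
    (he : ∀ n, e n ∈ solenoidalSubmodule D₀)
    (g g' : ℝ → L2Field) (n : ℕ) {t : ℝ} (ht : t ∈ Icc 0 T) :
    ‖g t - g' t‖ ^ 2 ≤ 3 * (Φ.defect e g n t + Φ.defect e g' n t +
      ∑ i ∈ Finset.range n, (Φ.coeff e g i t - Φ.coeff e g' i t) ^ 2) := by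
  unfold LevelDiffeo.defect
  simp_rw [coeff_eq_inner hD hD₀ he g _ ht, coeff_eq_inner hD hD₀ he g' _ ht]
  have hW : IsOrthonormalOrZero ((Φ.isCoordChange ht (hD t ht) hD₀).orthonormalL2 he) :=
    IsCoordChange.isOrthonormalOrZero_orthonormalL2 _ _
  exact hW.norm_sub_sq_le _ _ n

/-- Friedrichs' inequality integrated in time. Only the lower integral of `gradNorm` enters, so
its measurability in time is not needed. -/
theorem lintegral_defect_le (hD : ∀ t ∈ Icc 0 T, IsOpen (D t)) (hD₀ : IsOpen D₀)
    (he : ∀ n, e n ∈ solenoidalSubmodule D₀)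
    (hN : 0 ≤ N) (hT : 0 ≤ T) {ε : ℝ} (hε : 0 ≤ ε) {n : ℕ}
    (hn : ∀ t (ht : t ∈ Icc 0 T) (u : L2Field) (G : L2Grad), HasGradV (D t) u G →
      ‖u‖ ^ 2 - ∑ i ∈ Finset.range n,
        inner ℝ u ((Φ.isCoordChange ht (hD t ht) hD₀).orthonormalL2 he i) ^ 2 ≤
        ε * (‖u‖ ^ 2 + ‖G‖ ^ 2)) (hg : g ∈ setK Φ e N A) :
    ∫⁻ t in Icc 0 T, ENNReal.ofReal (Φ.defect e g n t) ≤
      ENNReal.ofReal (ε * (N ^ 2 * T + N)) := by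
  have hpt : ∀ᵐ t ∂timeMeasure T, ENNReal.ofReal (Φ.defect e g n t) ≤
      ENNReal.ofReal (ε * N ^ 2) + ENNReal.ofReal ε * gradNorm (D t) (g t) ^ 2 := by
    filter_upwards [hg.2.2.1, ae_restrict_mem measurableSet_Icc] with t hV ht
    refine le_add_mul_gradNorm_sq hV ENNReal.ofReal_ne_top fun G hG => ?_
    have h1 := hn t ht (g t) G hG
    have h2 := norm_le_of_mem_setK hg ht
    rw [← ofReal_norm, ← ENNReal.ofReal_pow (norm_nonneg _), ← ENNReal.ofReal_mul hε,
      ← ENNReal.ofReal_add (by positivity) (by positivity)]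
    refine ENNReal.ofReal_le_ofReal ?_
    unfold LevelDiffeo.defect
    simp_rw [coeff_eq_inner hD hD₀ he g _ ht]
    refine h1.trans ?_
    rw [mul_add]
    gcongr
  calc _ ≤ ∫⁻ t in Icc 0 T, (ENNReal.ofReal (ε * N ^ 2) +
        ENNReal.ofReal ε * gradNorm (D t) (g t) ^ 2) := lintegral_mono_ae hpt
    _ ≤ ENNReal.ofReal (ε * N ^ 2) * ENNReal.ofReal T + ENNReal.ofReal ε * ENNReal.ofReal N := by
        rw [lintegral_add_left measurable_const, lintegral_const_mul' _ _ ENNReal.ofReal_ne_top,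
          lintegral_const, Measure.restrict_apply_univ, Real.volume_Icc, sub_zero]
        gcongr
        exact hg.2.2.2.2.1
    _ = _ := by
        rw [← ENNReal.ofReal_mul (by positivity), ← ENNReal.ofReal_mul hε,
          ← ENNReal.ofReal_add (by positivity) (by positivity)]
        congr 1; ring

theorem lintegral_enorm_sub_sq_le (hD : ∀ t ∈ Icc 0 T, IsOpen (D t)) (hD₀ : IsOpen D₀)
    (he : ∀ n, e n ∈ solenoidalSubmodule D₀)
    (hA : ∀ i, EquicontFamily T (A i)) (hT : 0 ≤ T) {n : ℕ} {c ρ : ℝ}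
    (hc : 0 ≤ c) (hg : g ∈ setK Φ e N A)
    (hd : ∫⁻ t in Icc 0 T, ENNReal.ofReal (Φ.defect e g n t) ≤ ENNReal.ofReal c)
    (hd' : ∫⁻ t in Icc 0 T, ENNReal.ofReal (Φ.defect e g' n t) ≤ ENNReal.ofReal c)
    (hclose : ∀ i < n, ∀ t ∈ Icc 0 T, |Φ.coeff e g i t - Φ.coeff e g' i t| ≤ ρ) :
    ∫⁻ t in Icc 0 T, ‖g t - g' t‖ₑ ^ 2 ≤ ENNReal.ofReal (3 * (2 * c + n * ρ ^ 2 * T)) := by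
  have hpt : ∀ t ∈ Icc 0 T, ‖g t - g' t‖ₑ ^ 2 ≤ ENNReal.ofReal 3 *
      (ENNReal.ofReal (Φ.defect e g n t) + ENNReal.ofReal (Φ.defect e g' n t) +
        ENNReal.ofReal (n * ρ ^ 2)) := by
    intro t ht
    have h1 := defect_nonneg (Φ := Φ) hD hD₀ he g n ht
    have h2 := defect_nonneg (Φ := Φ) hD hD₀ he g' n ht
    have h3 : ∑ i ∈ Finset.range n, (Φ.coeff e g i t - Φ.coeff e g' i t) ^ 2 ≤ n * ρ ^ 2 := by
      calc _ ≤ ∑ i ∈ Finset.range n, ρ ^ 2 := by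
            refine Finset.sum_le_sum fun i hi => ?_
            rw [← sq_abs]
            have := hclose i (Finset.mem_range.1 hi) t ht
            gcongr
        _ = _ := by simp
    rw [← ofReal_norm, ← ENNReal.ofReal_pow (norm_nonneg _), ← ENNReal.ofReal_add h1 h2,
      ← ENNReal.ofReal_add (by positivity) (by positivity), ← ENNReal.ofReal_mul (by norm_num)]
    refine ENNReal.ofReal_le_ofReal ((norm_sub_sq_le_defect (Φ := Φ) hD hD₀ he g g' n ht).trans ?_)
    gcongr
  have hm := (aemeasurable_defect hA hg n).ennreal_ofReal
  calc _ ≤ _ := setLIntegral_mono' measurableSet_Icc hpt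
    _ ≤ ENNReal.ofReal 3 * (ENNReal.ofReal c + ENNReal.ofReal c +
          ENNReal.ofReal (n * ρ ^ 2) * ENNReal.ofReal T) := by
        rw [lintegral_const_mul' _ _ ENNReal.ofReal_ne_top, lintegral_add_right _ measurable_const,
          lintegral_add_left' hm, lintegral_const, Measure.restrict_apply_univ, Real.volume_Icc,
          sub_zero]
        gcongr
    _ = _ := by
        rw [← ENNReal.ofReal_mul (by positivity), ← ENNReal.ofReal_add hc hc,
          ← ENNReal.ofReal_add (by positivity) (by positivity), ← ENNReal.ofReal_mul (by norm_num)]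
        congr 2; ring

theorem L2H_dist_sq_le {f f' : L2H T D}
    (hf : (f : Lp L2Field 2 (timeMeasure T)) =ᵐ[timeMeasure T] g)
    (hf' : (f' : Lp L2Field 2 (timeMeasure T)) =ᵐ[timeMeasure T] g') {b : ℝ} (hb : 0 ≤ b)
    (h : ∫⁻ t in Icc 0 T, ‖g t - g' t‖ₑ ^ 2 ≤ ENNReal.ofReal b) : dist f f' ^ 2 ≤ b := by
  have h1 : ((f : Lp L2Field 2 (timeMeasure T)) - f' : Lp L2Field 2 (timeMeasure T))
      =ᵐ[timeMeasure T] fun t => g t - g' t := by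
    filter_upwards [Lp.coeFn_sub (f : Lp L2Field 2 (timeMeasure T)) f', hf, hf'] with t ht1 ht2 ht3
    rw [ht1, Pi.sub_apply, ht2, ht3]
  rw [← Lp.enorm_sq_eq_lintegral _ h1, ← ofReal_norm, ← ENNReal.ofReal_pow (norm_nonneg _),
    ENNReal.ofReal_le_ofReal_iff hb] at h
  rwa [Subtype.dist_eq, dist_eq_norm]

end SetK

/-- Members of the set with nearly the same first `n` coefficients at finitely many times are close,
if `n` is given by Friedrichs' inequality and the times by equicontinuity. -/
theorem totallyBounded_setK {T : ℝ} (hT : 0 ≤ T) {D : ℝ → Set Plane} {D₀ : Set Plane}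
    {Φ : LevelDiffeo T D D₀} (hD : ∀ t ∈ Icc 0 T, IsOpen (D t)) (hD₀ : IsOpen D₀)
    (hb : Bornology.IsBounded D₀) {e : ℕ → Plane → Plane} (he : IsGalerkinSequence D₀ e)
    {A : ℕ → Set (Icc (0 : ℝ) T → ℝ)} (hA : ∀ i, EquicontFamily T (A i)) {N : ℝ} (hN : 0 < N) :
    TotallyBounded {f : L2H T D | ∃ g ∈ setK Φ e N A,
      (f : Lp L2Field 2 (timeMeasure T)) =ᵐ[timeMeasure T] g} := by
  set S : Set (L2H T D) := {f : L2H T D | ∃ g ∈ setK Φ e N A,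
      (f : Lp L2Field 2 (timeMeasure T)) =ᵐ[timeMeasure T] g} with hS
  have hex : ∀ f : L2H T D, ∃ g : ℝ → L2Field, f ∈ S → g ∈ setK Φ e N A ∧
      (f : Lp L2Field 2 (timeMeasure T)) =ᵐ[timeMeasure T] g := fun f => by
    by_cases hf : f ∈ S
    · obtain ⟨g, hg⟩ := hf
      exact ⟨g, fun _ => hg⟩
    · exact ⟨0, fun h => absurd h hf⟩
  choose γ hγ using hex
  refine Metric.totallyBounded_iff.2 fun ε hε => ?_
  -- The integrated defects of two members take up at most half of `ε²`, and the differences of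
  -- their coefficients less than the other half.
  set M := N ^ 2 * T + N with hM
  have hM0 : 0 < M := by positivity
  obtain ⟨n, hn⟩ := Φ.exists_friedrichs hD hD₀ hb he (ε := ε ^ 2 / (12 * M)) (by positivity)
  have hdef : ∀ f ∈ S, ∫⁻ t in Icc 0 T, ENNReal.ofReal (Φ.defect e (γ f) n t) ≤
      ENNReal.ofReal (ε ^ 2 / 12) := fun f hf => by
    have := lintegral_defect_le hD hD₀ he.mem hN.le hT (by positivity) hn (hγ f hf).1
    rwa [← hM, div_mul_eq_mul_div, mul_div_mul_right _ _ hM0.ne'] at this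
  obtain ⟨η, hη, hηε⟩ : ∃ η : ℝ, 0 < η ∧ 3 * (n * (3 * η) ^ 2 * T) < ε ^ 2 / 2 := by
    have hcont : Filter.Tendsto (fun η : ℝ => 3 * (n * (3 * η) ^ 2 * T)) (nhdsWithin 0 (Ioi 0))
        (nhds (3 * (n * (3 * 0) ^ 2 * T))) :=
      (Continuous.tendsto (by fun_prop) 0).mono_left nhdsWithin_le_nhds
    have h0 : 3 * (n * (3 * 0) ^ 2 * T) < ε ^ 2 / 2 := by
      simp only [mul_zero, ne_eq, OfNat.ofNat_ne_zero, not_false_eq_true, zero_pow, zero_mul]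
      positivity
    have h1 : ∀ᶠ η : ℝ in nhdsWithin 0 (Ioi 0), 0 < η := self_mem_nhdsWithin
    exact (h1.and (hcont.eventually_lt_const h0)).exists
  obtain ⟨P, hPf, hP⟩ := EquicontFamily.exists_finite_times hA n hη
  have := hPf.fintype
  -- the coefficients of index below `n` at the times in `P`
  let φ : L2H T D → Fin n × P → ℝ := fun f p => Φ.coeff e (γ f) p.1 (p.2 : Icc (0 : ℝ) T)
  have hφ : Bornology.IsBounded (φ '' S) := by
    refine isBounded_iff_forall_norm_le.2 ⟨N, ?_⟩
    rintro _ ⟨f, hf, rfl⟩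
    exact (pi_norm_le_iff_of_nonneg hN.le).2 fun p =>
      abs_coeff_le hD hD₀ he.mem (hγ f hf).1 p.1 (p.2 : Icc (0 : ℝ) T).2
  obtain ⟨F, hFf, hFS, hF⟩ := exists_finite_net hφ hη
  refine ⟨F, hFf, fun f hf => ?_⟩
  obtain ⟨f', hf', hff'⟩ := hF f hf
  obtain ⟨hg, hfg⟩ := hγ f hf
  obtain ⟨hg', hfg'⟩ := hγ f' (hFS hf')
  refine mem_iUnion₂.2 ⟨f', hf', ?_⟩
  have hclose : ∀ i < n, ∀ t ∈ Icc 0 T,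
      |Φ.coeff e (γ f) i t - Φ.coeff e (γ f') i t| ≤ 3 * η := fun i hi t ht =>
    (hP i hi _ (coeff_mem_of_mem_setK hg i) _ (coeff_mem_of_mem_setK hg' i) (fun p hp =>
      (dist_le_pi_dist (φ f) (φ f') (⟨i, hi⟩, ⟨p, hp⟩)).trans_lt hff') ⟨t, ht⟩).le
  have hdist := L2H_dist_sq_le hfg hfg' (by positivity)
    (lintegral_enorm_sub_sq_le hD hD₀ he.mem hA hT (by positivity) hg (hdef f hf)
      (hdef f' (hFS hf')) hclose)
  rw [Metric.mem_ball]
  refine lt_of_pow_lt_pow_left₀ 2 hε.le ?_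
  nlinarith

theorem proposition4p2 {T : ℝ} (hT : 0 < T) (D : ℝ → Set Plane) (D₀ : Set Plane)
    (hD : ∀ t ∈ Set.Icc 0 T, IsOpen (D t) ∧ Bornology.IsBounded (D t))
    (hD₀ : IsOpen D₀ ∧ Bornology.IsBounded D₀)
    (Φ : LevelDiffeo T D D₀)
    (e : ℕ → Plane → Plane) (he : IsGalerkinSequence D₀ e)
    (A : ℕ → Set (Set.Icc (0 : ℝ) T → ℝ)) (hA : ∀ i, EquicontFamily T (A i))
    (N : ℝ) (hN : 0 < N) :
    (∀ g ∈ setK Φ e N A, ∃ f : L2H T D,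
      (f : Lp L2Field 2 (timeMeasure T)) =ᵐ[timeMeasure T] g) ∧
    IsCompact (closure {f : L2H T D | ∃ g ∈ setK Φ e N A,
      (f : Lp L2Field 2 (timeMeasure T)) =ᵐ[timeMeasure T] g}) := by
  refine ⟨fun g hg => exists_L2H_of_mem_setK hg, ?_⟩
  have := (isClosed_L2H T D).completeSpace_coe
  exact TotallyBounded.isCompact_of_isClosed (totallyBounded_setK hT.le (fun t ht => (hD t ht).1)
    hD₀.1 hD₀.2 he hA hN).closure isClosed_closure
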